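/- Let $p\ge 1$ be an integer and let $N,\sigma:[0,\infty)\to(0,\infty)$ be continuous at $r=0$ and continuously differentiable on $(0,\infty)$, with $N(0)=1$ and $\sigma(0)=\sigma_0\in(0,1)$. Put $$\ell(r)=r\left(\frac{\sigma'(r)}{\sigma(r)}+\frac{N'(r)}{N(r)}\right),\qquad r>0,$$ and assume that $0\le \ell(r)<1$ for all $r>0$; that $N(r)\to N_\infty>0$ as $r\to\infty$; that $r^2/N(r)=O(r^{\delta})$ as $r\to0^+$ and $\ell(r)=O(r^{-\gamma})$ as $r\to\infty$ for some constants $\delta,\gamma>0$; and that $\ell(r)\to0$ as $r\to0^+$. For $w_h\in[0,1]$ and $\Phi>0$ consider the Type II boundary value problem for differentiable functions $w,u:(0,\infty)\to\mathbb R$: $$\sqrt{\sigma N}\,w'+\frac{1}{\sqrt{\sigma N}}\,u\,w=0,\qquad \frac{r}{\sqrt{\sigma(2p-1)}}\left[(1-w^2)^{p-1}u\right]'-\frac{\sqrt{\sigma(2p-1)}}{r}(1-w^2)^p=0\qquad(r>0),$$ $$w(0^+)=w_h,\quad u(0^+)=0,\quad w(\infty)=0,\quad u(\infty)=\Phi.$$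 A solution is called nontrivial if $w\not\equiv0$. (i) For every $\Phi>0$ and every $w_h\in[0,1]$, the problem has a nontrivial solution if and only if $w_h=1$. In particular, for $w_h=1$ the constant $\Phi>0$ may be prescribed arbitrarily. (ii) Every nontrivial solution satisfies $w(r)>0$ and $u(r)>0$ for all $r>0$, and $w$ is strictly decreasing on $(0,\infty)$. (iii) Let $P(v)=\int_0^v(1-e^{2s})^{p-1}\,ds$, which is an increasing bijection of $(-\infty,0]$, and let $Q$ be its inverse there. For every $a>0$ there is exactly one $b=b(a)\in\mathbb R$ for which the initial value problem $$f_{\tau\tau}+\bigl(1-\ell(e^{-\tau})\bigr)f_\tau=-\frac{2p-1}{N(e^{-\tau})}\bigl(1-e^{2Q(f)}\bigr)^p\quad(\tau\ge0),\qquad f(0)=-a,\quad f_\tau(0)=b,$$ has a solution with $f_\tau>0$ and $f\le0$ for all $\tau>0$. For every $a>0$ there is a solution $(w,u)$ of the differential equations with $w(0^+)=1$, $u(0^+)=0$, $w(\infty)=0$, with $u(\infty)$ finite, and with $P(\ln w(1))=-a$; every such solution satisfies $\frac{d}{dt}P(\ln w(e^t))\big|_{t=0}=-b(a)$, and its limit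 $u(\infty)$ depends only on $a$. Denoting this limit by $\Phi(a)$, the function $\Phi(\cdot)$ is continuous on $(0,\infty)$ and its range is exactly $(0,\infty)$. -/

import Mathlib

open Filter Topology Asymptotics

noncomputable section

namespace TypeII

/-- The logarithmic derivative coefficient `r (σ'(r)/σ(r) + N'(r)/N(r))` of the background. -/
def logCoeff (N σ : ℝ → ℝ) (r : ℝ) : ℝ :=
  r * (deriv σ r / σ r + deriv N r / N r)

/-- `(w, u)` is a (real-valued, classical) solution on `0 < r < ∞` of the BPS system in dimension
`d = 4p` on the background `(N, σ)` with boundary values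
`w(0) = wh`, `u(0) = 0`, `w(∞) = 0`, `u(∞) = Φ`. -/
structure IsSolution (p : ℕ) (N σ : ℝ → ℝ) (wh Φ : ℝ) (w u : ℝ → ℝ) : Prop where
  differentiable_w : ∀ r, 0 < r → DifferentiableAt ℝ w r
  differentiable_u : ∀ r, 0 < r → DifferentiableAt ℝ u r
  eq_w : ∀ r, 0 < r →
    √(σ r * N r) * deriv w r + 1 / √(σ r * N r) * (u r * w r) = 0
  eq_u : ∀ r, 0 < r →
    r / √(σ r * (2 * p - 1)) * deriv (fun s => (1 - w s ^ 2) ^ (p - 1) * u s) r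
      - √(σ r * (2 * p - 1)) / r * (1 - w r ^ 2) ^ p = 0
  w_zero : Tendsto w (𝓝[>] 0) (𝓝 wh)
  u_zero : Tendsto u (𝓝[>] 0) (𝓝 0)
  w_infty : Tendsto w atTop (𝓝 0)
  u_infty : Tendsto u atTop (𝓝 Φ)

/-- A solution is nontrivial if `w` does not vanish identically on `r > 0`. -/
def Nontrivial (w : ℝ → ℝ) : Prop := ∃ r, 0 < r ∧ w r ≠ 0

/-- The substitution `P(v) = ∫₀ᵛ (1 - e^{2s})^{p-1} ds`, an increasing bijection of `(-∞, 0]`. -/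
def P (p : ℕ) (v : ℝ) : ℝ := ∫ s in (0 : ℝ)..v, (1 - Real.exp (2 * s)) ^ (p - 1)

/-- The inverse of `P` on `(-∞, 0]`. -/
def Q (p : ℕ) : ℝ → ℝ := Function.invFunOn (P p) (Set.Iic 0)

/-- The profile `f(t) = P(ln w(eᵗ))` attached to `w`. -/
def profile (p : ℕ) (w : ℝ → ℝ) (t : ℝ) : ℝ := P p (Real.log (w (Real.exp t)))

/-- The set of shooting slopes for the datum `a`: all `b` such that the solution on `τ ≥ 0` of
`f_ττ + f_τ - G(τ) f_τ = -H(τ) (1 - e^{2Q(f)})^p`, `f(0) = -a`, `f_τ(0) = b`,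
satisfies `f_τ > 0` and `f ≤ 0` for all `τ > 0`. Here `τ = -ln r`, `G` is the logarithmic
derivative coefficient at `r = e^{-τ}`, and `H = (2p-1)/N` at `r = e^{-τ}`. The function `f'` below
is the first derivative of `f`. -/
def shootingSlopes (p : ℕ) (N σ : ℝ → ℝ) (a : ℝ) : Set ℝ :=
  {b | ∃ f f' : ℝ → ℝ,
    f 0 = -a ∧ f' 0 = b ∧
    (∀ τ, 0 ≤ τ → HasDerivWithinAt f (f' τ) (Set.Ici 0) τ) ∧
    (∀ τ, 0 ≤ τ → HasDerivWithinAt f'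
      (-(f' τ) + logCoeff N σ (Real.exp (-τ)) * f' τ
        - (2 * p - 1) / N (Real.exp (-τ)) * (1 - Real.exp (2 * Q p (f τ))) ^ p)
      (Set.Ici 0) τ) ∧
    ∀ τ, 0 < τ → 0 < f' τ ∧ f τ ≤ 0}

end TypeII

end

/-!
Put `m = σ N`, `f = P (ln w)` and `F = (1 - w²)^{p-1} u`. In these unknowns the boundary value
problem becomes the planar system
`f' = -F / m`, `F' = (2p - 1) σ r⁻² h(f)`, where `h(x) = (1 - e^{2 Q(x)})^p` for `x ≤ 0`.
The substitution `P` is chosen so that `h` is Lipschitz, although `Q` is not differentiable at `0`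
for `p ≥ 2` (`isNonlinearity_nonlin`); moreover `h` is decreasing. The growth conditions enter
through uniform bounds on `N` and `m` (`exists_isBackground`), so that the coefficients of the
system are of order `1` and `r⁻²` on all of `(0, ∞)`.

Monotonicity of `h` gives the key fact `antitoneOn_mul_sub`: for two solutions, the product of the
differences `D = f₁ - f₂` and `G = F₁ - F₂` is nonincreasing in `r`, while `D²` has derivative
`-2 D G / m`. A solution with `f ≤ 0 ≤ F` on `(0, 1]` must tend to `f = 0` at `r = 0`, since
otherwise `F' ≥ η r⁻²` drives `F` to `-∞`. For two such solutions `D G` vanishes at `r = 0`, so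
`D G ≤ 0` and `D²` increases; hence `F(1)` is a Lipschitz function of `f(1)`
(`exists_lipschitz_shooting`). This is uniqueness of the shooting slope together with its continuity.
Existence is by shooting from `r = 1` (`exists_shooting`): the right value of `F(1)` is the largest one for which `f ≤ 0` on `(0, 1]`.
Because `F' ≤ C r⁻²`, the limit `Φ` of `F` at infinity is reached uniformly, so it is a continuous
function of `a = -f(1)`, also at the zero solution `a = 0`; with `Φ ≥ F(1) ≥ a / C` its range is
`(0, ∞)` (`exists_limit_function`).

It remains to compare the two problems. For a solution `(w, u)` with `w(0) < 1` one has
`F' ≥ η r⁻²` near `0`, contradicting `F → 0`. For `w(0) = 1`, comparison of `(f, F)` with the zero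
solution forces `0 < w < 1` and `F > 0` (`IsSolution.planar`). Conversely, a planar solution with
`f < 0 < F` gives `w = e^{Q(f)}` and `u = F / (1 - w²)^{p-1}`, and the only nontrivial boundary
condition is `u → 0` at `r = 0`, where the denominator degenerates. Near `0` the function `|f|`
has decay exponent `2p`; it suffices to know that `r F / |f|` is bounded and that
`|f| = O(r^{p + 1/2})`, which both follow from the monotonicity of
`r^k F - k m r^{k-1} |f|`, for large `k` and for `k = p + 1/2` respectively
(`IsGlobalDecaying.snd_le`, `IsGlobalDecaying.exists_decay`).
-/

/-! ### Global solvability of Lipschitz initial value problems -/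

/-- A vector field which is Lipschitz in space, with a constant depending continuously on time, and
which vanishes at the origin has integral curves defined for all times. The Picard operator is a
contraction of factor `1/2` on curves measured relative to the weight `cosh κ`, where `κ' = 2 K`,
since `∫₀ᵗ K cosh κ = sinh (κ t) / 2`. -/
theorem exists_global_integralCurve {E : Type*} [NormedAddCommGroup E] [NormedSpace ℝ E]
    [CompleteSpace E] (v : ℝ → E → E) (K : ℝ → ℝ) (hv : Continuous (Function.uncurry v))
    (hK : Continuous K) (hK0 : ∀ t, 0 ≤ K t) (hlip : ∀ t x y, ‖v t x - v t y‖ ≤ K t * ‖x - y‖)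
    (hzero : ∀ t, v t 0 = 0) (x₀ : E) :
    ∃ x : ℝ → E, x 0 = x₀ ∧ ∀ t, HasDerivAt x (v t (x t)) t := by
  set κ : ℝ → ℝ := fun t => ∫ s in (0 : ℝ)..t, 2 * K s with hκ
  have hκ' : ∀ t, HasDerivAt κ (2 * K t) t := fun t =>
    (continuous_const.mul hK).integral_hasStrictDerivAt 0 t |>.hasDerivAt
  have hκc : Continuous κ := continuous_iff_continuousAt.2 fun t => (hκ' t).continuousAt
  set e : ℝ → ℝ := fun t => Real.cosh (κ t) with he
  have hec : Continuous e := Real.continuous_cosh.comp hκc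
  have hepos : ∀ t, 0 < e t := fun t => Real.cosh_pos _
  have he1 : ∀ t, 1 ≤ e t := fun t => Real.one_le_cosh _
  have hint : ∀ t, |∫ s in (0 : ℝ)..t, K s * e s| ≤ e t / 2 := by
    intro t
    have h1 : ∫ s in (0 : ℝ)..t, K s * e s = Real.sinh (κ t) / 2 - Real.sinh (κ 0) / 2 := by
      apply intervalIntegral.integral_eq_sub_of_hasDerivAt (f := fun s => Real.sinh (κ s) / 2)
      · intro s _
        have := ((hκ' s).sinh).div_const 2
        rwa [show Real.cosh (κ s) * (2 * K s) / 2 = K s * Real.cosh (κ s) by ring] at this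
      · exact (hK.mul hec).intervalIntegrable _ _
    have h0 : κ 0 = 0 := by simp [hκ]
    rw [h1, h0, Real.sinh_zero, zero_div, sub_zero, abs_div, abs_two, Real.abs_sinh]
    have : Real.sinh |κ t| ≤ Real.cosh |κ t| := (Real.sinh_lt_cosh _).le
    rw [Real.cosh_abs] at this
    simp only [he]; linarith
  have hcont : ∀ y : BoundedContinuousFunction ℝ E, Continuous fun s => v s (e s • y s) := fun y =>
    hv.comp (continuous_id.prodMk (hec.smul y.continuous))
  -- the difference of two Picard integrals, relative to the weight
  have hdiff : ∀ (g : ℝ → E) (M : ℝ), (∀ s, ‖g s‖ ≤ K s * e s * M) → 0 ≤ M → ∀ t,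
      ‖∫ s in (0 : ℝ)..t, g s‖ ≤ e t / 2 * M := by
    intro g M hg hM t
    refine (intervalIntegral.norm_integral_le_abs_of_norm_le
      (g := fun s => K s * e s * M) (Eventually.of_forall fun s => hg s) ?_).trans ?_
    · exact ((hK.mul hec).mul continuous_const).intervalIntegrable _ _
    · rw [intervalIntegral.integral_mul_const, abs_mul, abs_of_nonneg hM]
      exact mul_le_mul_of_nonneg_right (hint t) hM
  have hgrow : ∀ (y : BoundedContinuousFunction ℝ E) s, ‖v s (e s • y s)‖ ≤ K s * e s * ‖y‖ := by
    intro y s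
    have h1 := hlip s (e s • y s) 0
    rw [hzero, sub_zero, sub_zero, norm_smul, Real.norm_of_nonneg (hepos s).le] at h1
    refine h1.trans ?_
    rw [mul_assoc]
    exact mul_le_mul_of_nonneg_left
      (mul_le_mul_of_nonneg_left (y.norm_coe_le_norm s) (hepos s).le) (hK0 s)
  let T : BoundedContinuousFunction ℝ E → BoundedContinuousFunction ℝ E := fun y =>
    BoundedContinuousFunction.ofNormedAddCommGroup
      (fun t => (e t)⁻¹ • (x₀ + ∫ s in (0 : ℝ)..t, v s (e s • y s)))
      ((hec.inv₀ fun t => (hepos t).ne').smul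
        (continuous_const.add (intervalIntegral.continuous_primitive
          (fun a b => (hcont y).intervalIntegrable a b) 0)))
      (‖x₀‖ + ‖y‖) (by
        intro t
        rw [norm_smul, norm_inv, Real.norm_of_nonneg (hepos t).le, inv_mul_le_iff₀ (hepos t)]
        have h1 := hdiff _ ‖y‖ (hgrow y) (norm_nonneg _) t
        have h2 := norm_add_le x₀ (∫ s in (0 : ℝ)..t, v s (e s • y s))
        nlinarith [he1 t, norm_nonneg x₀, norm_nonneg y, mul_nonneg (hepos t).le (norm_nonneg y)])
  have hT : ContractingWith (1 / 2) T := by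
    refine ⟨by norm_num, LipschitzWith.of_dist_le_mul fun y z => ?_⟩
    rw [BoundedContinuousFunction.dist_le (by positivity)]
    intro t
    change dist ((e t)⁻¹ • (x₀ + ∫ s in (0 : ℝ)..t, v s (e s • y s)))
      ((e t)⁻¹ • (x₀ + ∫ s in (0 : ℝ)..t, v s (e s • z s))) ≤ _
    rw [dist_eq_norm, ← smul_sub, add_sub_add_left_eq_sub, ← intervalIntegral.integral_sub
      ((hcont y).intervalIntegrable _ _) ((hcont z).intervalIntegrable _ _), norm_smul, norm_inv,
      Real.norm_of_nonneg (hepos t).le, inv_mul_le_iff₀ (hepos t)]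
    have h1 := hdiff (fun s => v s (e s • y s) - v s (e s • z s)) (dist y z) (fun s => by
      refine (hlip s _ _).trans ?_
      rw [← smul_sub, norm_smul, Real.norm_of_nonneg (hepos s).le, mul_assoc, ← dist_eq_norm]
      exact mul_le_mul_of_nonneg_left
        (mul_le_mul_of_nonneg_left (BoundedContinuousFunction.dist_coe_le_dist s) (hepos s).le)
        (hK0 s)) dist_nonneg t
    refine h1.trans (le_of_eq ?_)
    push_cast; ring
  obtain ⟨y, hy⟩ : ∃ y, T y = y := ⟨_, hT.fixedPoint_isFixedPt⟩
  have hy' : ∀ t, e t • y t = x₀ + ∫ s in (0 : ℝ)..t, v s (e s • y s) := by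
    intro t
    have h1 : (e t)⁻¹ • (x₀ + ∫ s in (0 : ℝ)..t, v s (e s • y s)) = y t :=
      congrArg (fun z : BoundedContinuousFunction ℝ E => z t) hy
    rw [← h1, smul_inv_smul₀ (hepos t).ne']
  refine ⟨fun t => e t • y t, by simp [hy' 0], fun t => ?_⟩
  have h1 : HasDerivAt (fun t => x₀ + ∫ s in (0 : ℝ)..t, v s (e s • y s)) (v t (e t • y t)) t :=
    ((hcont y).integral_hasStrictDerivAt 0 t).hasDerivAt.const_add x₀
  exact h1.congr_of_eventuallyEq (Eventually.of_forall hy')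

namespace TypeII

/-! ### Monotone planar systems -/

/-- The function `h` vanishes at `0`, is positive on the negative axis, antitone, bounded above by
`1` and `L`-Lipschitz. -/
structure IsNonlinearity (h : ℝ → ℝ) (L : ℝ) : Prop where
  zero : h 0 = 0
  anti : Antitone h
  lip : ∀ x y, |h x - h y| ≤ L * |x - y|
  le_one : ∀ x, h x ≤ 1
  pos : ∀ x, x < 0 → 0 < h x

/-- The coefficients `α, β` of the planar system are continuous on `(0, ∞)`, with `α` of
order `1` and `β` of order `r⁻²`, uniformly up to both ends. -/
structure IsCoeffPair (α β : ℝ → ℝ) (c C : ℝ) : Prop where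
  c_pos : 0 < c
  α_lower : ∀ r, 0 < r → c ≤ α r
  α_upper : ∀ r, 0 < r → α r ≤ C
  β_lower : ∀ r, 0 < r → c / r ^ 2 ≤ β r
  β_upper : ∀ r, 0 < r → β r ≤ C / r ^ 2
  α_cont : ContinuousOn α (Set.Ioi 0)
  β_cont : ContinuousOn β (Set.Ioi 0)

/-- `(f, F)` solves the planar system `f' = -α F`, `F' = β h(f)` at every point of `s`. -/
def IsFlowOn (α β h : ℝ → ℝ) (s : Set ℝ) (f F : ℝ → ℝ) : Prop :=
  ∀ r ∈ s, HasDerivAt f (-(α r * F r)) r ∧ HasDerivAt F (β r * h (f r)) r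

/-- A solution on `(0, 1]` with `f ≤ 0 ≤ F`. Such a solution decays at `r = 0`. Only
continuity is required at the end point `r = 1`. -/
structure IsDecaying (α β h : ℝ → ℝ) (f F : ℝ → ℝ) : Prop where
  cont_f : ContinuousOn f (Set.Ioc 0 1)
  cont_F : ContinuousOn F (Set.Ioc 0 1)
  flow : IsFlowOn α β h (Set.Ioo 0 1) f F
  sign : ∀ r ∈ Set.Ioo (0 : ℝ) 1, f r ≤ 0 ∧ 0 ≤ F r

/-- A solution on all of `(0, ∞)` with `f ≤ 0 ≤ F`. The zero solution is included. -/
structure IsGlobalDecaying (α β h : ℝ → ℝ) (f F : ℝ → ℝ) : Prop where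
  flow : IsFlowOn α β h (Set.Ioi 0) f F
  sign : ∀ r, 0 < r → f r ≤ 0 ∧ 0 ≤ F r

theorem neg_of_ne_zero {s : Set ℝ} (hs : s.OrdConnected) {f : ℝ → ℝ} (hf : ContinuousOn f s)
    (h0 : ∀ x ∈ s, f x ≠ 0) {x₀ : ℝ} (hx₀ : x₀ ∈ s) (hneg : f x₀ < 0) : ∀ x ∈ s, f x < 0 := by
  intro x hx
  by_contra hcon
  obtain ⟨z, hz, hz0⟩ := hs.isPreconnected.intermediate_value hx₀ hx hf
    (Set.mem_Icc.2 ⟨hneg.le, not_lt.1 hcon⟩)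
  exact h0 z hz hz0

theorem monotoneOn_of_hasDerivAt {s : Set ℝ} (hs : Convex ℝ s) {f f' : ℝ → ℝ}
    (hf : ContinuousOn f s) (hf' : ∀ x ∈ interior s, HasDerivAt f (f' x) x)
    (h0 : ∀ x ∈ interior s, 0 ≤ f' x) : MonotoneOn f s :=
  monotoneOn_of_hasDerivWithinAt_nonneg hs hf (fun x hx => (hf' x hx).hasDerivWithinAt) h0

theorem antitoneOn_of_hasDerivAt {s : Set ℝ} (hs : Convex ℝ s) {f f' : ℝ → ℝ}
    (hf : ContinuousOn f s) (hf' : ∀ x ∈ interior s, HasDerivAt f (f' x) x)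
    (h0 : ∀ x ∈ interior s, f' x ≤ 0) : AntitoneOn f s :=
  antitoneOn_of_hasDerivWithinAt_nonpos hs hf (fun x hx => (hf' x hx).hasDerivWithinAt) h0

theorem hasDerivAt_const_div (η : ℝ) {r : ℝ} (hr : 0 < r) :
    HasDerivAt (fun s => η / s) (-(η / r ^ 2)) r := by
  have := (hasDerivAt_inv hr.ne').const_mul η
  simpa [div_eq_mul_inv] using this

/-- A function whose derivative dominates `η / r²` is unbounded below at `r = 0`. -/
theorem not_bddBelow_of_deriv_ge {F F' : ℝ → ℝ} {r₀ η B : ℝ} (hr₀ : 0 < r₀) (hη : 0 < η)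
    (hF : ∀ r ∈ Set.Ioo 0 r₀, HasDerivAt F (F' r) r) (hF' : ∀ r ∈ Set.Ioo 0 r₀, η / r ^ 2 ≤ F' r)
    (hB : ∀ r ∈ Set.Ioo 0 r₀, B ≤ F r) : False := by
  have hd : ∀ r ∈ Set.Ioo 0 r₀, HasDerivAt (fun s => F s + η / s) (F' r + -(η / r ^ 2)) r :=
    fun r hr => (hF r hr).add (hasDerivAt_const_div η hr.1)
  have hmono : MonotoneOn (fun s => F s + η / s) (Set.Ioo 0 r₀) :=
    monotoneOn_of_hasDerivAt (convex_Ioo _ _)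
      (fun r hr => (hd r hr).continuousAt.continuousWithinAt)
      (fun r hr => hd r (interior_subset hr))
      (fun r hr => by linarith [hF' r (interior_subset hr)])
  have h1 : r₀ / 2 ∈ Set.Ioo 0 r₀ := ⟨by linarith, by linarith⟩
  set T := |F (r₀ / 2) + η / (r₀ / 2) - B| + 1 with hT
  have hT0 : 0 < T := by positivity
  have hr : min (r₀ / 2) (η / T) ∈ Set.Ioo 0 r₀ :=
    ⟨lt_min h1.1 (by positivity), (min_le_left _ _).trans_lt h1.2⟩
  have h2 := hmono hr h1 (min_le_left _ _)
  have h3 : T ≤ η / min (r₀ / 2) (η / T) := by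
    rw [le_div_iff₀ hr.1, mul_comm, ← le_div_iff₀ hT0]
    exact min_le_right _ _
  have h4 := hB _ hr
  have h5 := le_abs_self (F (r₀ / 2) + η / (r₀ / 2) - B)
  simp only at h2
  linarith

theorem IsNonlinearity.lip_nonneg {h : ℝ → ℝ} {L : ℝ} (hh : IsNonlinearity h L) : 0 ≤ L := by
  have := (abs_nonneg _).trans (hh.lip 1 0)
  simpa using this

theorem IsNonlinearity.continuous {h : ℝ → ℝ} {L : ℝ} (hh : IsNonlinearity h L) :
    Continuous h := by
  refine LipschitzWith.continuous (K := ⟨L, hh.lip_nonneg⟩)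
    (LipschitzWith.of_dist_le_mul fun x y => ?_)
  rw [Real.dist_eq, Real.dist_eq]
  exact hh.lip x y

theorem IsNonlinearity.nonneg {h : ℝ → ℝ} {L : ℝ} (hh : IsNonlinearity h L) {x : ℝ} (hx : x ≤ 0) :
    0 ≤ h x := hh.zero ▸ hh.anti hx

theorem IsNonlinearity.mul_sub_nonpos {h : ℝ → ℝ} {L : ℝ} (hh : IsNonlinearity h L) (x y : ℝ) :
    (x - y) * (h x - h y) ≤ 0 := by
  rcases le_total x y with hxy | hxy
  · exact mul_nonpos_of_nonpos_of_nonneg (by linarith) (by linarith [hh.anti hxy])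
  · exact mul_nonpos_of_nonneg_of_nonpos (by linarith) (by linarith [hh.anti hxy])

section Planar

variable {α β h : ℝ → ℝ} {c C L : ℝ}

theorem IsCoeffPair.α_pos (hc : IsCoeffPair α β c C) {r : ℝ} (hr : 0 < r) : 0 < α r :=
  hc.c_pos.trans_le (hc.α_lower r hr)

theorem IsCoeffPair.C_pos (hc : IsCoeffPair α β c C) : 0 < C :=
  (hc.α_pos one_pos).trans_le (hc.α_upper 1 one_pos)

theorem IsCoeffPair.β_pos (hc : IsCoeffPair α β c C) {r : ℝ} (hr : 0 < r) : 0 < β r :=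
  (div_pos hc.c_pos (by positivity)).trans_le (hc.β_lower r hr)

theorem IsFlowOn.mono {s t : Set ℝ} {f F : ℝ → ℝ} (hf : IsFlowOn α β h t f F) (hst : s ⊆ t) :
    IsFlowOn α β h s f F := fun r hr => hf r (hst hr)

theorem IsFlowOn.continuousOn_fst {s : Set ℝ} {f F : ℝ → ℝ} (hf : IsFlowOn α β h s f F) :
    ContinuousOn f s := fun r hr => (hf r hr).1.continuousAt.continuousWithinAt

theorem IsFlowOn.continuousOn_snd {s : Set ℝ} {f F : ℝ → ℝ} (hf : IsFlowOn α β h s f F) :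
    ContinuousOn F s := fun r hr => (hf r hr).2.continuousAt.continuousWithinAt

theorem isFlowOn_zero (hh : IsNonlinearity h L) (s : Set ℝ) :
    IsFlowOn α β h s (fun _ => 0) (fun _ => 0) := by
  intro r _
  constructor
  · simpa using hasDerivAt_const r (0 : ℝ)
  · simpa [hh.zero] using hasDerivAt_const r (0 : ℝ)

theorem isGlobalDecaying_zero (hh : IsNonlinearity h L) :
    IsGlobalDecaying α β h (fun _ => 0) (fun _ => 0) :=
  ⟨isFlowOn_zero hh _, fun _ _ => ⟨le_rfl, le_rfl⟩⟩

theorem IsGlobalDecaying.isDecaying {f F : ℝ → ℝ} (hf : IsGlobalDecaying α β h f F) :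
    IsDecaying α β h f F where
  cont_f := hf.flow.continuousOn_fst.mono fun _ hr => hr.1
  cont_F := hf.flow.continuousOn_snd.mono fun _ hr => hr.1
  flow := hf.flow.mono fun _ hr => hr.1
  sign r hr := hf.sign r hr.1

/-- The product of the differences of two solutions is nonincreasing. This is where the
monotonicity of `h` enters. -/
theorem antitoneOn_mul_sub (hc : IsCoeffPair α β c C) (hh : IsNonlinearity h L) {s : Set ℝ}
    (hs : Convex ℝ s) (hs0 : s ⊆ Set.Ioi 0) {f F g G : ℝ → ℝ} (hf : ContinuousOn f s)
    (hF : ContinuousOn F s) (hg : ContinuousOn g s) (hG : ContinuousOn G s)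
    (hfF : IsFlowOn α β h (interior s) f F) (hgG : IsFlowOn α β h (interior s) g G) :
    AntitoneOn (fun r => (f r - g r) * (F r - G r)) s := by
  refine antitoneOn_of_hasDerivAt hs ((hf.sub hg).mul (hF.sub hG))
    (fun r hr => ((hfF r hr).1.sub (hgG r hr).1).mul ((hfF r hr).2.sub (hgG r hr).2)) ?_
  intro r hr
  have hr0 : 0 < r := hs0 (interior_subset hr)
  have h1 := mul_nonneg (hc.α_pos hr0).le (sq_nonneg (F r - G r))
  have h2 := mul_nonpos_of_nonneg_of_nonpos (hc.β_pos hr0).le (hh.mul_sub_nonpos (f r) (g r))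
  simp only [Pi.sub_apply]
  nlinarith

/-- The square of the difference of the first components has the monotonicity opposite to the sign
of the product of the differences. -/
theorem hasDerivAt_sub_sq {f F g G : ℝ → ℝ} {r : ℝ}
    (hf : HasDerivAt f (-(α r * F r)) r) (hg : HasDerivAt g (-(α r * G r)) r) :
    HasDerivAt (fun r => (f r - g r) ^ 2) (-(2 * α r * ((f r - g r) * (F r - G r)))) r := by
  have h1 : HasDerivAt (fun r => (f r - g r) ^ 2) _ r := (hf.sub hg).pow 2
  refine h1.congr_deriv ?_
  simp only [Pi.sub_apply]
  push_cast
  ring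

theorem IsDecaying.monotoneOn_snd (hc : IsCoeffPair α β c C) (hh : IsNonlinearity h L)
    {f F : ℝ → ℝ} (hf : IsDecaying α β h f F) : MonotoneOn F (Set.Ioc 0 1) := by
  refine monotoneOn_of_hasDerivAt (convex_Ioc _ _) hf.cont_F
    (fun r hr => (hf.flow r (by rwa [interior_Ioc] at hr)).2) fun r hr => ?_
  rw [interior_Ioc] at hr
  exact mul_nonneg (hc.β_pos hr.1).le (hh.nonneg (hf.sign r hr).1)

theorem IsDecaying.antitoneOn_fst (hc : IsCoeffPair α β c C)
    {f F : ℝ → ℝ} (hf : IsDecaying α β h f F) : AntitoneOn f (Set.Ioc 0 1) := by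
  refine antitoneOn_of_hasDerivAt (convex_Ioc _ _) hf.cont_f
    (fun r hr => (hf.flow r (by rwa [interior_Ioc] at hr)).1) fun r hr => ?_
  rw [interior_Ioc] at hr
  exact neg_nonpos.2 (mul_nonneg (hc.α_pos hr.1).le (hf.sign r hr).2)

/-- If `f` stayed away from `0`, then `F' ≥ η / r²` would force `F` to become negative. -/
theorem IsDecaying.tendsto_fst (hc : IsCoeffPair α β c C) (hh : IsNonlinearity h L)
    {f F : ℝ → ℝ} (hf : IsDecaying α β h f F) : Tendsto f (𝓝[>] 0) (𝓝 0) := by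
  rw [Metric.tendsto_nhds]
  intro ε hε
  obtain ⟨r₀, hr₀, hfr₀⟩ : ∃ r₀ ∈ Set.Ioo (0 : ℝ) 1, -ε < f r₀ := by
    by_contra! hcon
    refine not_bddBelow_of_deriv_ge (F := F) one_pos (mul_pos hc.c_pos (hh.pos (-ε) (by linarith)))
      (fun r hr => (hf.flow r hr).2) (fun r hr => ?_) (fun r hr => (hf.sign r hr).2)
    rw [mul_div_right_comm]
    exact mul_le_mul (hc.β_lower r hr.1) (hh.anti (hcon r hr)) (hh.nonneg (by linarith))
      (hc.β_pos hr.1).le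
  filter_upwards [Ioo_mem_nhdsGT hr₀.1] with r hr
  have h1 := hf.antitoneOn_fst hc ⟨hr.1, (hr.2.trans hr₀.2).le⟩ ⟨hr₀.1, hr₀.2.le⟩ hr.2.le
  rw [Real.dist_eq, sub_zero, abs_lt]
  exact ⟨by linarith, by linarith [(hf.sign r ⟨hr.1, hr.2.trans hr₀.2⟩).1]⟩

/-- For two decaying solutions the antitone product of the differences vanishes in the limit
`r → 0`, hence is nonpositive. -/
theorem IsDecaying.mul_sub_nonpos (hc : IsCoeffPair α β c C) (hh : IsNonlinearity h L)
    {f F g G : ℝ → ℝ} (hf : IsDecaying α β h f F) (hg : IsDecaying α β h g G) :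
    ∀ r ∈ Set.Ioc (0 : ℝ) 1, (f r - g r) * (F r - G r) ≤ 0 := by
  have hanti := antitoneOn_mul_sub hc hh (convex_Ioc (0 : ℝ) 1) (fun r hr => hr.1) hf.cont_f
    hf.cont_F hg.cont_f hg.cont_F (by rw [interior_Ioc]; exact hf.flow)
    (by rw [interior_Ioc]; exact hg.flow)
  have hlim : Tendsto (fun r => (f r - g r) * (F r - G r)) (𝓝[>] 0) (𝓝 0) := by
    have h1 : Tendsto (fun r => f r - g r) (𝓝[>] 0) (𝓝 0) := by
      simpa using (hf.tendsto_fst hc hh).sub (hg.tendsto_fst hc hh)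
    refine squeeze_zero_norm' (a := fun r => |f r - g r| * (F 1 + G 1)) ?_ ?_
    · filter_upwards [Ioo_mem_nhdsGT one_pos] with r hr
      have h2 := hf.monotoneOn_snd hc hh ⟨hr.1, hr.2.le⟩ ⟨one_pos, le_rfl⟩ hr.2.le
      have h3 := hg.monotoneOn_snd hc hh ⟨hr.1, hr.2.le⟩ ⟨one_pos, le_rfl⟩ hr.2.le
      have h4 := (hf.sign r hr).2
      have h5 := (hg.sign r hr).2
      rw [norm_mul, Real.norm_eq_abs, Real.norm_eq_abs]
      exact mul_le_mul_of_nonneg_left (abs_le.2 ⟨by linarith, by linarith⟩) (abs_nonneg _)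
    · simpa using h1.abs.mul_const (F 1 + G 1)
  intro r hr
  refine ge_of_tendsto hlim ?_
  filter_upwards [Ioo_mem_nhdsGT hr.1] with s hs
  exact hanti ⟨hs.1, hs.2.le.trans hr.2⟩ hr hs.2.le

/-- The datum `F(1)` of a decaying solution is a Lipschitz function of `f(1)`; in particular it is
determined by `f(1)`. -/
theorem exists_lipschitz_shooting (hc : IsCoeffPair α β c C) (hh : IsNonlinearity h L) :
    ∃ M : ℝ, ∀ f F g G : ℝ → ℝ, IsDecaying α β h f F → IsDecaying α β h g G →
      |F 1 - G 1| ≤ M * |f 1 - g 1| := by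
  refine ⟨4 / c + 4 * C * L, fun f F g G hf hg => ?_⟩
  have hsub : Set.Icc (1 / 2 : ℝ) 1 ⊆ Set.Ioc 0 1 := fun x hx => ⟨by linarith [hx.1], hx.2⟩
  have hsub' : Set.Ioo (1 / 2 : ℝ) 1 ⊆ Set.Ioo 0 1 := fun x hx => ⟨by linarith [hx.1], hx.2⟩
  have hmono : MonotoneOn (fun r => (f r - g r) ^ 2) (Set.Ioc 0 1) := by
    refine monotoneOn_of_hasDerivAt (f' := fun r => -(2 * α r * ((f r - g r) * (F r - G r))))
      (convex_Ioc _ _) ((hf.cont_f.sub hg.cont_f).pow 2) (fun r hr => ?_) fun r hr => ?_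
    · rw [interior_Ioc] at hr
      exact hasDerivAt_sub_sq (hf.flow r hr).1 (hg.flow r hr).1
    · rw [interior_Ioc] at hr
      have h1 := hf.mul_sub_nonpos hc hh hg r ⟨hr.1, hr.2.le⟩
      have h2 := hc.α_pos hr.1
      nlinarith
  have hD : ∀ r ∈ Set.Ioc (0 : ℝ) 1, |f r - g r| ≤ |f 1 - g 1| := fun r hr =>
    sq_le_sq.1 (hmono hr ⟨one_pos, le_rfl⟩ hr.2)
  obtain ⟨ξ, hξ, hξe⟩ := exists_hasDerivAt_eq_slope (fun r => f r - g r)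
    (fun r => -(α r * F r) - -(α r * G r)) (by norm_num : (1 / 2 : ℝ) < 1)
    ((hf.cont_f.sub hg.cont_f).mono hsub)
    (fun r hr => (hf.flow r (hsub' hr)).1.sub (hg.flow r (hsub' hr)).1)
  have hξ0 : 0 < ξ := by linarith [hξ.1]
  have h1 : c * |F ξ - G ξ| ≤ 4 * |f 1 - g 1| := by
    have h2 : α ξ * (F ξ - G ξ) = -2 * ((f 1 - g 1) - (f (1 / 2) - g (1 / 2))) := by
      have : -(α ξ * F ξ) - -(α ξ * G ξ) = 2 * ((f 1 - g 1) - (f (1 / 2) - g (1 / 2))) := by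
        rw [hξe]; ring
      linarith
    have h3 : α ξ * |F ξ - G ξ| = 2 * |(f 1 - g 1) - (f (1 / 2) - g (1 / 2))| := by
      rw [← abs_of_pos (hc.α_pos hξ0), ← abs_mul, h2, abs_mul]; norm_num
    have h4 := abs_sub (f 1 - g 1) (f (1 / 2) - g (1 / 2))
    have h5 := hD (1 / 2) ⟨by norm_num, by norm_num⟩
    have h6 := mul_le_mul_of_nonneg_right (hc.α_lower ξ hξ0) (abs_nonneg (F ξ - G ξ))
    linarith
  obtain ⟨ζ, hζ, hζe⟩ := exists_hasDerivAt_eq_slope (fun r => F r - G r)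
    (fun r => β r * h (f r) - β r * h (g r)) hξ.2
    ((hf.cont_F.sub hg.cont_F).mono fun x hx => ⟨hξ0.trans_le hx.1, hx.2⟩)
    (fun r hr => (hf.flow r ⟨hξ0.trans hr.1, hr.2⟩).2.sub (hg.flow r ⟨hξ0.trans hr.1, hr.2⟩).2)
  have hζ0 : 0 < ζ := hξ0.trans hζ.1
  have h2 : |(F 1 - G 1) - (F ξ - G ξ)| ≤ 4 * C * L * |f 1 - g 1| := by
    have h3 : (F 1 - G 1) - (F ξ - G ξ) = β ζ * (h (f ζ) - h (g ζ)) * (1 - ξ) := by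
      have : 1 - ξ ≠ 0 := by linarith [hξ.2]
      rw [eq_div_iff this] at hζe
      rw [← hζe]; ring
    have h4 : |h (f ζ) - h (g ζ)| ≤ L * |f 1 - g 1| := (hh.lip _ _).trans
      (mul_le_mul_of_nonneg_left (hD ζ ⟨hζ0, hζ.2.le⟩) hh.lip_nonneg)
    have h5 : β ζ ≤ 4 * C := by
      refine (hc.β_upper ζ hζ0).trans ?_
      rw [div_le_iff₀ (by positivity)]
      have : (1 / 2 : ℝ) < ζ := hξ.1.trans hζ.1
      have : 1 ≤ 4 * ζ ^ 2 := by nlinarith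
      nlinarith [hc.C_pos]
    have hξ1 : |1 - ξ| ≤ 1 := abs_le.2 ⟨by linarith [hξ.2], by linarith⟩
    rw [h3, abs_mul, abs_mul, abs_of_pos (hc.β_pos hζ0)]
    have h6 := mul_le_mul h5 h4 (abs_nonneg _) (by linarith [hc.C_pos])
    have h7 := mul_nonneg (hc.β_pos hζ0).le (abs_nonneg (h (f ζ) - h (g ζ)))
    nlinarith
  have h3 : |F ξ - G ξ| ≤ 4 / c * |f 1 - g 1| := by
    rw [div_mul_eq_mul_div, le_div_iff₀ hc.c_pos]; linarith
  have h4 := abs_sub_abs_le_abs_sub (F 1 - G 1) (F ξ - G ξ)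
  linarith

/-- Gronwall's inequality for the squared distance of two solutions, in both directions. -/
theorem exists_energy_bound (hc : IsCoeffPair α β c C) (hh : IsNonlinearity h L) {s R : ℝ}
    (hs : 0 < s) :
    ∃ M : ℝ, 0 < M ∧ ∀ f F g G : ℝ → ℝ, IsFlowOn α β h (Set.Ioi 0) f F →
      IsFlowOn α β h (Set.Ioi 0) g G → ∀ r ∈ Set.Icc s R, ∀ r₀ ∈ Set.Icc s R,
        (f r - g r) ^ 2 + (F r - G r) ^ 2 ≤ M * ((f r₀ - g r₀) ^ 2 + (F r₀ - G r₀) ^ 2) := by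
  set k := C + C / s ^ 2 * L with hk
  have hk0 : 0 ≤ k := by have := hc.C_pos; have := hh.lip_nonneg; positivity
  refine ⟨Real.exp (k * (R - s)), Real.exp_pos _, fun f F g G hf hg => ?_⟩
  set E : ℝ → ℝ := fun r => (f r - g r) ^ 2 + (F r - G r) ^ 2 with hE
  set E' : ℝ → ℝ := fun r => -(2 * α r * ((f r - g r) * (F r - G r)))
    + 2 * (F r - G r) * (β r * h (f r) - β r * h (g r)) with hE'
  have hder : ∀ r, 0 < r → HasDerivAt E (E' r) r := by
    intro r hr
    refine (hasDerivAt_sub_sq (hf r hr).1 (hg r hr).1).add ?_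
    have h1 : HasDerivAt (fun r => (F r - G r) ^ 2) _ r := ((hf r hr).2.sub (hg r hr).2).pow 2
    refine h1.congr_deriv ?_
    simp only [Pi.sub_apply]
    push_cast
    ring
  have hbound : ∀ r, s ≤ r → |E' r| ≤ k * E r := by
    intro r hsr
    have hr : 0 < r := hs.trans_le hsr
    have hα := hc.α_upper r hr
    have hβ : β r ≤ C / s ^ 2 := (hc.β_upper r hr).trans
      (div_le_div_of_nonneg_left hc.C_pos.le (by positivity) (by gcongr))
    have h1 : |E' r| ≤ 2 * α r * (|f r - g r| * |F r - G r|)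
        + 2 * |F r - G r| * (β r * (L * |f r - g r|)) := by
      refine (abs_add_le _ _).trans (add_le_add (le_of_eq ?_) ?_)
      · rw [abs_neg, abs_mul, abs_mul, abs_mul, abs_two, abs_of_pos (hc.α_pos hr)]
      · rw [← mul_sub, abs_mul, abs_mul, abs_mul, abs_two, abs_of_pos (hc.β_pos hr)]
        exact mul_le_mul_of_nonneg_left
          (mul_le_mul_of_nonneg_left (hh.lip _ _) (hc.β_pos hr).le) (by positivity)
    have h2 : 2 * (|f r - g r| * |F r - G r|) ≤ E r := by
      have := two_mul_le_add_sq |f r - g r| |F r - G r|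
      rw [sq_abs, sq_abs] at this
      simp only [hE]; linarith
    have h3 : α r + β r * L ≤ k := add_le_add hα (mul_le_mul_of_nonneg_right hβ hh.lip_nonneg)
    have h4 : 0 ≤ α r + β r * L :=
      add_nonneg (hc.α_pos hr).le (mul_nonneg (hc.β_pos hr).le hh.lip_nonneg)
    calc |E' r| ≤ _ := h1
      _ = (α r + β r * L) * (2 * (|f r - g r| * |F r - G r|)) := by ring
      _ ≤ k * E r := mul_le_mul h3 h2 (by positivity) hk0
  have hexp : ∀ (a r : ℝ), HasDerivAt (fun r => Real.exp (a * r)) (Real.exp (a * r) * a) r := by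
    intro a r
    simpa using ((hasDerivAt_id r).const_mul a).exp
  have hpos : ∀ {r}, r ∈ Set.Icc s R → 0 < r := fun hr => hs.trans_le hr.1
  have hup : MonotoneOn (fun r => E r * Real.exp (k * r)) (Set.Icc s R) := by
    refine monotoneOn_of_hasDerivAt (convex_Icc _ _)
      (fun r hr => ((hder r (hpos hr)).mul (hexp k r)).continuousAt.continuousWithinAt)
      (fun r hr => (hder r (hpos (interior_subset hr))).mul (hexp k r)) fun r hr => ?_
    have h1 := (abs_le.1 (hbound r (interior_subset hr).1)).1
    have h2 := Real.exp_pos (k * r)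
    nlinarith
  have hdown : AntitoneOn (fun r => E r * Real.exp (-k * r)) (Set.Icc s R) := by
    refine antitoneOn_of_hasDerivAt (convex_Icc _ _)
      (fun r hr => ((hder r (hpos hr)).mul (hexp (-k) r)).continuousAt.continuousWithinAt)
      (fun r hr => (hder r (hpos (interior_subset hr))).mul (hexp (-k) r)) fun r hr => ?_
    have h1 := (abs_le.1 (hbound r (interior_subset hr).1)).2
    have h2 := Real.exp_pos (-k * r)
    nlinarith
  intro r hr r₀ hr₀
  change E r ≤ Real.exp (k * (R - s)) * E r₀
  have hE0 : 0 ≤ E r₀ := by positivity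
  suffices h1 : E r ≤ Real.exp (k * |r - r₀|) * E r₀ by
    refine h1.trans (mul_le_mul_of_nonneg_right (Real.exp_le_exp.2
      (mul_le_mul_of_nonneg_left ?_ hk0)) hE0)
    exact abs_le.2 ⟨by linarith [hr.1, hr₀.2], by linarith [hr.2, hr₀.1]⟩
  rcases le_total r r₀ with hle | hle
  · have h1 := hup hr hr₀ hle
    simp only at h1
    rw [abs_of_nonpos (by linarith), show k * -(r - r₀) = k * r₀ - k * r by ring, Real.exp_sub,
      div_mul_eq_mul_div, le_div_iff₀ (Real.exp_pos _)]
    linarith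
  · have h1 := hdown hr₀ hr hle
    simp only at h1
    rw [abs_of_nonneg (by linarith), show k * (r - r₀) = -k * r₀ - -k * r by ring, Real.exp_sub,
      div_mul_eq_mul_div, le_div_iff₀ (Real.exp_pos _)]
    linarith

theorem IsFlowOn.eq_zero (hc : IsCoeffPair α β c C) (hh : IsNonlinearity h L) {f F : ℝ → ℝ}
    (hf : IsFlowOn α β h (Set.Ioi 0) f F) {r₀ : ℝ} (hr₀ : 0 < r₀) (h1 : f r₀ = 0) (h2 : F r₀ = 0)
    {r : ℝ} (hr : 0 < r) : f r = 0 := by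
  obtain ⟨M, -, hM⟩ := exists_energy_bound (R := max r r₀) hc hh (lt_min hr hr₀)
  have h3 := hM f F _ _ hf (isFlowOn_zero hh _) r ⟨min_le_left _ _, le_max_left _ _⟩ r₀
    ⟨min_le_right _ _, le_max_right _ _⟩
  rw [h1, h2] at h3
  simp only [sub_zero, ne_eq, OfNat.ofNat_ne_zero, not_false_eq_true, zero_pow, add_zero,
    mul_zero] at h3
  nlinarith [sq_nonneg (F r), sq_nonneg (f r)]

/-- Solvability of the initial value problem posed at `r = 1`, on all of `(0, ∞)`, by the
substitution `r = eᵗ`. -/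
theorem exists_flow (hc : IsCoeffPair α β c C) (hh : IsNonlinearity h L) (a b : ℝ) :
    ∃ f F : ℝ → ℝ, f 1 = a ∧ F 1 = b ∧ IsFlowOn α β h (Set.Ioi 0) f F := by
  set A : ℝ → ℝ := fun t => Real.exp t * α (Real.exp t) with hA
  set B : ℝ → ℝ := fun t => Real.exp t * β (Real.exp t) with hB
  have hAc : Continuous A := Real.continuous_exp.mul
    (hc.α_cont.comp_continuous Real.continuous_exp Real.exp_pos)
  have hBc : Continuous B := Real.continuous_exp.mul
    (hc.β_cont.comp_continuous Real.continuous_exp Real.exp_pos)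
  have hA0 : ∀ t, 0 ≤ A t := fun t =>
    mul_nonneg (Real.exp_pos t).le (hc.α_pos (Real.exp_pos t)).le
  have hB0 : ∀ t, 0 ≤ B t := fun t =>
    mul_nonneg (Real.exp_pos t).le (hc.β_pos (Real.exp_pos t)).le
  obtain ⟨x, hx0, hx⟩ := exists_global_integralCurve
    (fun t (x : ℝ × ℝ) => (-(A t * x.2), B t * h x.1)) (fun t => A t + B t * L)
    (by
      have := hh.continuous
      fun_prop)
    (by fun_prop) (fun t => add_nonneg (hA0 t) (mul_nonneg (hB0 t) hh.lip_nonneg))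
    (by
      intro t x y
      have h1 : |x.1 - y.1| ≤ ‖x - y‖ := norm_fst_le (x - y)
      have h2 : |x.2 - y.2| ≤ ‖x - y‖ := norm_snd_le (x - y)
      have h3 := hh.lip_nonneg
      have h4 := mul_nonneg (hB0 t) h3
      rw [Prod.norm_def, Prod.fst_sub, Prod.snd_sub, Real.norm_eq_abs, Real.norm_eq_abs]
      refine max_le ?_ ?_
      · rw [show -(A t * x.2) - -(A t * y.2) = -(A t * (x.2 - y.2)) by ring, abs_neg, abs_mul,
          abs_of_nonneg (hA0 t)]
        nlinarith [mul_le_mul_of_nonneg_left h2 (hA0 t), mul_nonneg h4 (norm_nonneg (x - y))]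
      · rw [← mul_sub, abs_mul, abs_of_nonneg (hB0 t)]
        have h5 := mul_le_mul_of_nonneg_left (hh.lip x.1 y.1) (hB0 t)
        have h6 := mul_le_mul_of_nonneg_left h1 h4
        nlinarith [mul_nonneg (hA0 t) (norm_nonneg (x - y))])
    (by intro t; simp [hh.zero]) (a, b)
  refine ⟨fun r => (x (Real.log r)).1, fun r => (x (Real.log r)).2, by simp [hx0],
    by simp [hx0], fun r (hr : 0 < r) => ?_⟩
  have h1 := (hx (Real.log r)).scomp r (Real.hasDerivAt_log hr.ne')
  have h2 : HasDerivAt (fun r => (x (Real.log r)).1) _ r := h1.fst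
  have h3 : HasDerivAt (fun r => (x (Real.log r)).2) _ r := h1.snd
  constructor
  · convert h2 using 1
    simp only [hA, Real.exp_log hr, Prod.smul_fst, smul_eq_mul]
    field_simp
  · convert h3 using 1
    simp only [hB, Real.exp_log hr, Prod.smul_snd, smul_eq_mul]
    field_simp

/-! ### Shooting from `r = 1` towards `r = 0` -/

/-- Once `f < 0` and `F ≤ 0`, the value of `f` only decreases towards `r = 0`. -/
theorem IsFlowOn.le_of_neg (hc : IsCoeffPair α β c C) (hh : IsNonlinearity h L) {f F : ℝ → ℝ}
    (hf : IsFlowOn α β h (Set.Ioi 0) f F) {r₀ : ℝ} (h1 : f r₀ < 0) (h2 : F r₀ ≤ 0) :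
    ∀ r ∈ Set.Ioc 0 r₀, f r ≤ f r₀ := by
  intro r hr
  have hr₀ : r₀ ∈ Set.Ioc 0 r₀ := ⟨hr.1.trans_le hr.2, le_rfl⟩
  have hsub : Set.Ioc 0 r₀ ⊆ Set.Ioi 0 := fun x hx => hx.1
  have hprod := antitoneOn_mul_sub hc hh (convex_Ioc 0 r₀) hsub (hf.continuousOn_fst.mono hsub)
    (hf.continuousOn_snd.mono hsub) continuousOn_const continuousOn_const
    (hf.mono (interior_subset.trans hsub)) (isFlowOn_zero hh _)
  have hsq : AntitoneOn (fun r => (f r - 0) ^ 2) (Set.Ioc 0 r₀) := by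
    refine antitoneOn_of_hasDerivAt (f' := fun r => -(2 * α r * ((f r - 0) * (F r - 0))))
      (convex_Ioc _ _) (((hf.continuousOn_fst.mono hsub).sub continuousOn_const).pow 2)
      (fun x hx => hasDerivAt_sub_sq (g := fun _ => 0) (G := fun _ => 0)
        (hf x (hsub (interior_subset hx))).1
        (isFlowOn_zero (α := α) (β := β) hh (Set.Ioi 0) x (hsub (interior_subset hx))).1)
      fun x hx => ?_
    have hx' := interior_subset hx
    have h3 := hprod hx' hr₀ hx'.2
    have h4 := hc.α_pos hx'.1
    simp only [sub_zero] at h3 ⊢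
    have h5 : 0 ≤ f r₀ * F r₀ := mul_nonneg_of_nonpos_of_nonpos h1.le h2
    nlinarith [mul_nonneg h4.le (h5.trans h3)]
  simp only [sub_zero] at hsq
  have hneg := neg_of_ne_zero Set.ordConnected_Ioc (hf.continuousOn_fst.mono hsub)
    (fun x hx h0 => by
      have h3 := hsq hx hr₀ hx.2
      simp only [h0] at h3
      nlinarith) hr₀ h1 r hr
  have h3 := hsq hr hr₀ hr.2
  simp only at h3
  nlinarith

/-- If `f < 0 < F` at `r₀`, then these signs persist for `r ≥ r₀`, because `f F` is antitone. -/
theorem IsFlowOn.sign_of_le (hc : IsCoeffPair α β c C) (hh : IsNonlinearity h L) {f F : ℝ → ℝ}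
    (hf : IsFlowOn α β h (Set.Ioi 0) f F) {r₀ : ℝ} (hr₀ : 0 < r₀) (h1 : f r₀ < 0) (h2 : 0 < F r₀) :
    ∀ r, r₀ ≤ r → f r < 0 ∧ 0 < F r := by
  have hsub : Set.Ici r₀ ⊆ Set.Ioi 0 := fun x hx => hr₀.trans_le hx
  have hprod := antitoneOn_mul_sub hc hh (convex_Ici r₀) hsub (hf.continuousOn_fst.mono hsub)
    (hf.continuousOn_snd.mono hsub) continuousOn_const continuousOn_const
    (hf.mono (interior_subset.trans hsub)) (isFlowOn_zero hh _)
  simp only [sub_zero] at hprod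
  have h3 : ∀ x ∈ Set.Ici r₀, f x * F x < 0 := fun x hx =>
    (hprod Set.self_mem_Ici hx hx).trans_lt (mul_neg_of_neg_of_pos h1 h2)
  have h4 := neg_of_ne_zero Set.ordConnected_Ici (hf.continuousOn_fst.mono hsub)
    (fun x hx h0 => by have := h3 x hx; rw [h0, zero_mul] at this; exact lt_irrefl _ this)
    Set.self_mem_Ici h1
  exact fun r hr => ⟨h4 r hr, pos_of_mul_neg_right (h3 r hr) (h4 r hr).le⟩

/-- For every datum `f(1) = -a < 0` some solution satisfies `f < 0 < F` on `(0, ∞)`. The value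
`F(1)` is the largest one for which `f` stays nonpositive on `(0, 1]`: if `F` were nonpositive
somewhere on `(0, 1]`, a slightly larger value would still have this property. -/
theorem exists_shooting (hc : IsCoeffPair α β c C) (hh : IsNonlinearity h L) {a : ℝ} (ha : 0 < a) :
    ∃ f F : ℝ → ℝ, IsFlowOn α β h (Set.Ioi 0) f F ∧ f 1 = -a ∧ ∀ r, 0 < r → f r < 0 ∧ 0 < F r := by
  choose f F hf1 hF1 hflow using exists_flow hc hh (-a)
  set S : Set ℝ := {b | 0 ≤ b ∧ ∀ r ∈ Set.Ioc (0 : ℝ) 1, f b r ≤ 0} with hS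
  have hS0 : (0 : ℝ) ∈ S := by
    refine ⟨le_rfl, fun r hr => ?_⟩
    have := (hflow 0).le_of_neg hc hh (r₀ := 1) (by rw [hf1]; linarith) (by rw [hF1]) r hr
    rw [hf1] at this
    linarith
  have hSb : BddAbove S := by
    refine ⟨4 * C + 2 * a / c, fun b hb => ?_⟩
    have hsub : ∀ {x : ℝ}, 1 / 2 ≤ x → x ∈ Set.Ioi (0 : ℝ) := fun hx =>
      lt_of_lt_of_le (by norm_num) hx
    obtain ⟨ξ, hξ, hξe⟩ := exists_hasDerivAt_eq_slope (f b) (fun r => -(α r * F b r))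
      (by norm_num : (1 / 2 : ℝ) < 1)
      ((hflow b).continuousOn_fst.mono fun x hx => hsub hx.1)
      fun r hr => (hflow b r (hsub hr.1.le)).1
    have hξ0 : 0 < ξ := hsub hξ.1.le
    obtain ⟨ζ, hζ, hζe⟩ := exists_hasDerivAt_eq_slope (F b) (fun r => β r * h (f b r)) hξ.2
      ((hflow b).continuousOn_snd.mono fun x hx => hξ0.trans_le hx.1)
      fun r hr => (hflow b r (hξ0.trans hr.1)).2
    have hζ0 : 0 < ζ := hξ0.trans hζ.1
    rw [hf1] at hξe
    rw [eq_div_iff (by linarith [hξ.2]), hF1] at hζe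
    have h1 := hb.2 (1 / 2) ⟨by norm_num, by norm_num⟩
    have h2 : α ξ * F b ξ ≤ 2 * a := by
      rw [eq_div_iff (by norm_num)] at hξe
      linarith
    have h3 : F b ξ ≤ 2 * a / c := by
      rw [le_div_iff₀ hc.c_pos]
      rcases le_total (F b ξ) 0 with h0 | h0
      · nlinarith [hc.c_pos]
      · nlinarith [hc.α_lower ξ hξ0]
    have h4 : β ζ * h (f b ζ) ≤ 4 * C := by
      have h5 : β ζ ≤ 4 * C := by
        refine (hc.β_upper ζ hζ0).trans ?_
        rw [div_le_iff₀ (by positivity)]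
        have h6 : (1 / 2 : ℝ) < ζ := hξ.1.trans hζ.1
        have h7 : 1 ≤ 4 * ζ ^ 2 := by nlinarith
        nlinarith [hc.C_pos]
      have h8 := mul_le_mul_of_nonneg_left (hh.le_one (f b ζ)) (hc.β_pos hζ0).le
      linarith
    have h5 : β ζ * h (f b ζ) * (1 - ξ) ≤ 4 * C := by
      have h6 : 0 ≤ β ζ * h (f b ζ) := mul_nonneg (hc.β_pos hζ0).le
        (hh.nonneg (hb.2 ζ ⟨hζ0, hζ.2.le⟩))
      nlinarith
    linarith
  set b₀ := sSup S with hb₀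
  have hb₀0 : 0 ≤ b₀ := le_csSup hSb hS0
  -- continuous dependence on `b`, uniform on `[s, 1]`
  have hdep : ∀ s, 0 < s → ∀ ε, 0 < ε → ∃ δ, 0 < δ ∧ ∀ b, |b - b₀| ≤ δ → ∀ r ∈ Set.Icc s 1,
      |f b r - f b₀ r| < ε ∧ |F b r - F b₀ r| < ε := by
    intro s hs ε hε
    obtain ⟨M, hM0, hM⟩ := exists_energy_bound (R := 1) hc hh hs
    refine ⟨ε / (2 * √M), by positivity, fun b hb r hr => ?_⟩
    have h1 := hM _ _ _ _ (hflow b) (hflow b₀) r hr 1 ⟨hr.1.trans hr.2, le_rfl⟩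
    rw [hf1, hf1, hF1, hF1, sub_self, zero_pow two_ne_zero, zero_add] at h1
    have h2 : M * (b - b₀) ^ 2 < ε ^ 2 := by
      have h3 : (b - b₀) ^ 2 ≤ (ε / (2 * √M)) ^ 2 := by
        rw [← sq_abs]; exact pow_le_pow_left₀ (abs_nonneg _) hb 2
      have h4 : M * (ε / (2 * √M)) ^ 2 = ε ^ 2 / 4 := by
        rw [div_pow, mul_pow, Real.sq_sqrt hM0.le]
        field_simp
        norm_num
      have h5 : 0 < ε ^ 2 := by positivity
      nlinarith [mul_le_mul_of_nonneg_left h3 hM0.le]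
    constructor
    · refine abs_lt_of_sq_lt_sq ?_ hε.le
      linarith [sq_nonneg (F b r - F b₀ r)]
    · refine abs_lt_of_sq_lt_sq ?_ hε.le
      linarith [sq_nonneg (f b r - f b₀ r)]
  have hb₀S : ∀ r ∈ Set.Ioc (0 : ℝ) 1, f b₀ r ≤ 0 := by
    intro r hr
    by_contra! hcon
    obtain ⟨δ, hδ, hδ'⟩ := hdep r hr.1 _ hcon
    obtain ⟨b, hbS, hb⟩ := exists_lt_of_lt_csSup ⟨0, hS0⟩ (show b₀ - δ < sSup S by linarith)
    have h1 := le_csSup hSb hbS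
    have h2 := (hδ' b (abs_le.2 ⟨by linarith, by linarith⟩) r ⟨le_rfl, hr.2⟩).1
    have h3 := (abs_lt.1 h2).1
    linarith [hbS.2 r hr]
  have hneg : ∀ r ∈ Set.Ioc (0 : ℝ) 1, f b₀ r < 0 := by
    intro r hr
    refine (hb₀S r hr).lt_of_ne fun h0 => ?_
    have hr1 : r < 1 := hr.2.lt_of_ne fun h1 => by
      rw [h1, hf1] at h0; linarith
    have hmax : IsLocalMax (f b₀) r := by
      filter_upwards [Ioo_mem_nhds hr.1 hr1] with x hx
      rw [h0]; exact hb₀S x ⟨hx.1, hx.2.le⟩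
    have h1 := hmax.hasDerivAt_eq_zero (hflow b₀ r hr.1).1
    have h2 : F b₀ r = 0 := by
      have := (hc.α_pos hr.1).ne'
      simpa [this] using h1
    have h3 := (hflow b₀).eq_zero hc hh hr.1 h0 h2 one_pos
    rw [hf1] at h3
    linarith
  have hpos : ∀ r ∈ Set.Ioc (0 : ℝ) 1, 0 < F b₀ r := by
    intro r₀ hr₀
    by_contra! hcon
    have hstrict : StrictMonoOn (F b₀) (Set.Ioc 0 1) := by
      refine strictMonoOn_of_hasDerivWithinAt_pos (convex_Ioc _ _)
        ((hflow b₀).continuousOn_snd.mono fun x hx => hx.1)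
        (fun x hx => (hflow b₀ x (interior_subset hx).1).2.hasDerivWithinAt) fun x hx => ?_
      exact mul_pos (hc.β_pos (interior_subset hx).1) (hh.pos _ (hneg x (interior_subset hx)))
    have hs : 0 < r₀ / 2 := half_pos hr₀.1
    have hs1 : r₀ / 2 ≤ 1 := by linarith [hr₀.2]
    have h1 : F b₀ (r₀ / 2) < 0 :=
      (hstrict ⟨hs, hs1⟩ hr₀ (half_lt_self hr₀.1)).trans_le hcon
    obtain ⟨x, hx, hxmax⟩ := isCompact_Icc.exists_isMaxOn (Set.nonempty_Icc.2 hs1)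
      ((hflow b₀).continuousOn_fst.mono fun y (hy : y ∈ Set.Icc (r₀ / 2) 1) => hs.trans_le hy.1)
    have hfx := hneg x ⟨hs.trans_le hx.1, hx.2⟩
    obtain ⟨δ, hδ, hδ'⟩ := hdep (r₀ / 2) hs (min (-f b₀ x) (-F b₀ (r₀ / 2)))
      (lt_min (by linarith) (by linarith))
    have hδ'' := hδ' (b₀ + δ) (by rw [add_sub_cancel_left, abs_of_pos hδ])
    have h2 : ∀ r ∈ Set.Icc (r₀ / 2) 1, f (b₀ + δ) r < 0 := fun r hr => by
      have h3 := (abs_lt.1 ((hδ'' r hr).1.trans_le (min_le_left _ _))).2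
      have h4 : f b₀ r ≤ f b₀ x := hxmax hr
      linarith
    have h3 : F (b₀ + δ) (r₀ / 2) < 0 := by
      have := (abs_lt.1 ((hδ'' (r₀ / 2) ⟨le_rfl, hs1⟩).2.trans_le (min_le_right _ _))).2
      linarith
    have h4 : b₀ + δ ∈ S := by
      refine ⟨by linarith, fun r hr => ?_⟩
      rcases le_total r (r₀ / 2) with hle | hle
      · exact ((hflow _).le_of_neg hc hh (h2 _ ⟨le_rfl, hs1⟩) h3.le r ⟨hr.1, hle⟩).trans
          (h2 _ ⟨le_rfl, hs1⟩).le
      · exact (h2 r ⟨hle, hr.2⟩).le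
    linarith [le_csSup hSb h4]
  refine ⟨f b₀, F b₀, hflow b₀, hf1 b₀, fun r hr => ?_⟩
  rcases le_total r 1 with h1 | h1
  · exact ⟨hneg r ⟨hr, h1⟩, hpos r ⟨hr, h1⟩⟩
  · exact (hflow b₀).sign_of_le hc hh one_pos (hneg 1 ⟨one_pos, le_rfl⟩)
      (hpos 1 ⟨one_pos, le_rfl⟩) r h1

/-! ### The limit at infinity as a function of the datum -/

theorem IsGlobalDecaying.monotoneOn_snd (hc : IsCoeffPair α β c C) (hh : IsNonlinearity h L)
    {f F : ℝ → ℝ} (hf : IsGlobalDecaying α β h f F) : MonotoneOn F (Set.Ioi 0) := by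
  refine monotoneOn_of_hasDerivAt (convex_Ioi _) hf.flow.continuousOn_snd
    (fun r hr => (hf.flow r (interior_subset hr)).2) fun r hr => ?_
  have hr' : 0 < r := interior_subset hr
  exact mul_nonneg (hc.β_pos hr').le (hh.nonneg (hf.sign r hr').1)

theorem IsGlobalDecaying.antitoneOn_snd_add (hc : IsCoeffPair α β c C) (hh : IsNonlinearity h L)
    {f F : ℝ → ℝ} (hf : IsGlobalDecaying α β h f F) :
    AntitoneOn (fun r => F r + C / r) (Set.Ioi 0) := by
  have hd : ∀ r, 0 < r →
      HasDerivAt (fun r => F r + C / r) (β r * h (f r) + -(C / r ^ 2)) r := fun r hr =>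
    (hf.flow r hr).2.add (hasDerivAt_const_div C hr)
  refine antitoneOn_of_hasDerivAt (convex_Ioi _)
    (fun r hr => (hd r hr).continuousAt.continuousWithinAt)
    (fun r hr => hd r (interior_subset hr)) fun r hr => ?_
  have hr' : 0 < r := interior_subset hr
  have h1 := mul_le_mul_of_nonneg_left (hh.le_one (f r)) (hc.β_pos hr').le
  linarith [hc.β_upper r hr']

theorem IsGlobalDecaying.exists_tendsto_snd (hc : IsCoeffPair α β c C) (hh : IsNonlinearity h L)
    {f F : ℝ → ℝ} (hf : IsGlobalDecaying α β h f F) : ∃ Φ, Tendsto F atTop (𝓝 Φ) := by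
  have hpos : ∀ r : ℝ, 0 < max r 1 := fun r => lt_max_of_lt_right one_pos
  have h1 : Monotone fun r : ℝ => F (max r 1) := fun r s hrs =>
    hf.monotoneOn_snd hc hh (hpos r) (hpos s) (max_le_max_right 1 hrs)
  have h2 : BddAbove (Set.range fun r : ℝ => F (max r 1)) := by
    refine ⟨F 1 + C / 1, ?_⟩
    rintro _ ⟨r, rfl⟩
    have h3 := hf.antitoneOn_snd_add hc hh (Set.mem_Ioi.2 one_pos) (hpos r) (le_max_right r 1)
    have h4 : 0 ≤ C / max r 1 := div_nonneg hc.C_pos.le (hpos r).le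
    simp only at h3 ⊢
    linarith
  refine ⟨_, (tendsto_atTop_ciSup h1 h2).congr' ?_⟩
  filter_upwards [eventually_ge_atTop 1] with r hr
  rw [max_eq_left hr]

theorem IsGlobalDecaying.limit_bounds (hc : IsCoeffPair α β c C) (hh : IsNonlinearity h L)
    {f F : ℝ → ℝ} (hf : IsGlobalDecaying α β h f F) {Φ : ℝ} (hΦ : Tendsto F atTop (𝓝 Φ)) {R : ℝ}
    (hR : 0 < R) : F R ≤ Φ ∧ Φ ≤ F R + C / R := by
  constructor
  · refine ge_of_tendsto hΦ ?_
    filter_upwards [eventually_ge_atTop R] with r hr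
    exact hf.monotoneOn_snd hc hh hR (hR.trans_le hr) hr
  · refine le_of_tendsto hΦ ?_
    filter_upwards [eventually_ge_atTop R] with r hr
    have h1 := hf.antitoneOn_snd_add hc hh (Set.mem_Ioi.2 hR) (Set.mem_Ioi.2 (hR.trans_le hr)) hr
    have h2 : 0 ≤ C / r := div_nonneg hc.C_pos.le (hR.trans_le hr).le
    simp only at h1
    linarith

/-- The limit of `F` at infinity depends uniformly continuously on `f(1)`. The zero solution is
admitted, which gives the behaviour for small data. -/
theorem exists_delta_limit (hc : IsCoeffPair α β c C) (hh : IsNonlinearity h L) {ε : ℝ}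
    (hε : 0 < ε) :
    ∃ δ, 0 < δ ∧ ∀ (f F g G : ℝ → ℝ) (Φ Ψ : ℝ), IsGlobalDecaying α β h f F →
      IsGlobalDecaying α β h g G → Tendsto F atTop (𝓝 Φ) → Tendsto G atTop (𝓝 Ψ) →
        |f 1 - g 1| < δ → |Φ - Ψ| < ε := by
  obtain ⟨M, hM⟩ := exists_lipschitz_shooting hc hh
  set R := max 1 (2 * C / ε) with hR
  have hR0 : 0 < R := lt_max_of_lt_left one_pos
  have hCR : C / R ≤ ε / 2 := by
    rw [div_le_iff₀ hR0]
    have h1 : 2 * C / ε ≤ R := le_max_right _ _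
    rw [div_le_iff₀ hε] at h1
    linarith
  obtain ⟨M', hM'0, hM'⟩ := exists_energy_bound (R := R) hc hh one_pos
  set k := M' * (1 + M ^ 2) with hk
  have hk0 : 0 < k := by positivity
  refine ⟨ε / (2 * √k), by positivity, fun f F g G Φ Ψ hf hg hΦ hΨ hδ => ?_⟩
  have h1 := hM' f F g G hf.flow hg.flow R ⟨le_max_left _ _, le_rfl⟩ 1 ⟨le_rfl, le_max_left _ _⟩
  have h2 : (F 1 - G 1) ^ 2 ≤ M ^ 2 * (f 1 - g 1) ^ 2 := by
    rw [← sq_abs (F 1 - G 1), ← sq_abs (f 1 - g 1), ← mul_pow]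
    exact pow_le_pow_left₀ (abs_nonneg _) (hM f F g G hf.isDecaying hg.isDecaying) 2
  have h3 : |F R - G R| < ε / 2 := by
    refine abs_lt_of_sq_lt_sq ?_ (by positivity)
    have h4 : (f 1 - g 1) ^ 2 < (ε / (2 * √k)) ^ 2 := by
      rw [← sq_abs]; exact pow_lt_pow_left₀ hδ (abs_nonneg _) two_ne_zero
    have h5 : k * (ε / (2 * √k)) ^ 2 = (ε / 2) ^ 2 := by
      rw [div_pow, mul_pow, Real.sq_sqrt hk0.le]
      field_simp
    have h6 := mul_lt_mul_of_pos_left h4 hk0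
    have h7 := mul_le_mul_of_nonneg_left h2 hM'0.le
    have h8 : k * (f 1 - g 1) ^ 2 = M' * (f 1 - g 1) ^ 2 + M' * (M ^ 2 * (f 1 - g 1) ^ 2) := by
      rw [hk]; ring
    nlinarith [sq_nonneg (f R - g R)]
  have h4 := hf.limit_bounds hc hh hΦ hR0
  have h5 := hg.limit_bounds hc hh hΨ hR0
  have h6 := abs_lt.1 h3
  exact abs_lt.2 ⟨by linarith, by linarith⟩

theorem IsGlobalDecaying.le_snd_one (hc : IsCoeffPair α β c C) (hh : IsNonlinearity h L)
    {f F : ℝ → ℝ} (hf : IsGlobalDecaying α β h f F) : -f 1 ≤ C * F 1 := by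
  have hd : ∀ r, 0 < r → HasDerivAt (fun r => f r + C * F 1 * r)
      (-(α r * F r) + C * F 1) r := fun r hr => by
    have h1 : HasDerivAt (fun r => f r + C * F 1 * r) (-(α r * F r) + C * F 1 * 1) r :=
      (hf.flow r hr).1.add ((hasDerivAt_id r).const_mul (C * F 1))
    rwa [mul_one] at h1
  have hmono : MonotoneOn (fun r => f r + C * F 1 * r) (Set.Ioc 0 1) := by
    refine monotoneOn_of_hasDerivAt (convex_Ioc _ _)
      (fun r hr => (hd r hr.1).continuousAt.continuousWithinAt)
      (fun r hr => hd r (interior_subset hr).1) fun r hr => ?_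
    have hr' := interior_subset hr
    have h1 := hf.monotoneOn_snd hc hh hr'.1 (Set.mem_Ioi.2 one_pos) hr'.2
    have h2 := mul_le_mul (hc.α_upper r hr'.1) h1 (hf.sign r hr'.1).2 hc.C_pos.le
    linarith
  have hlim : Tendsto (fun r => f r + C * F 1 * r) (𝓝[>] 0) (𝓝 0) := by
    have h1 : Tendsto (fun r : ℝ => C * F 1 * r) (𝓝[>] 0) (𝓝 (C * F 1 * 0)) :=
      ((continuous_const.mul continuous_id).tendsto 0).mono_left nhdsWithin_le_nhds
    simpa using (hf.isDecaying.tendsto_fst hc hh).add h1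
  have h1 : 0 ≤ f 1 + C * F 1 * 1 := by
    refine le_of_tendsto hlim ?_
    filter_upwards [Ioo_mem_nhdsGT one_pos] with r hr
    exact hmono ⟨hr.1, hr.2.le⟩ ⟨one_pos, le_rfl⟩ hr.2.le
  linarith

/-- The shooting map and the limit map of the planar system. -/
theorem exists_limit_function (hc : IsCoeffPair α β c C) (hh : IsNonlinearity h L) :
    ∃ B Φ : ℝ → ℝ,
      (∀ a, 0 < a → ∃ f F : ℝ → ℝ, IsFlowOn α β h (Set.Ioi 0) f F ∧
        (∀ r, 0 < r → f r < 0 ∧ 0 < F r) ∧ f 1 = -a ∧ F 1 = B a ∧ Tendsto F atTop (𝓝 (Φ a))) ∧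
      (∀ a, 0 < a → ∀ f F, IsDecaying α β h f F → f 1 = -a → F 1 = B a) ∧
      (∀ a, 0 < a → ∀ f F Ψ, IsGlobalDecaying α β h f F → f 1 = -a → Tendsto F atTop (𝓝 Ψ) →
        Ψ = Φ a) ∧
      ContinuousOn Φ (Set.Ioi 0) ∧ Φ '' Set.Ioi 0 = Set.Ioi 0 := by
  choose! f F hflow hf1 hsign using fun (a : ℝ) (ha : 0 < a) => exists_shooting hc hh ha
  have hglob : ∀ a, 0 < a → IsGlobalDecaying α β h (f a) (F a) := fun a ha =>
    ⟨hflow a ha, fun r hr => ⟨(hsign a ha r hr).1.le, (hsign a ha r hr).2.le⟩⟩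
  choose! Φ hΦ using fun (a : ℝ) (ha : 0 < a) => (hglob a ha).exists_tendsto_snd hc hh
  have hcont : ContinuousOn Φ (Set.Ioi 0) := by
    intro a ha
    rw [Metric.continuousWithinAt_iff]
    intro ε hε
    obtain ⟨δ, hδ, hδ'⟩ := exists_delta_limit hc hh hε
    refine ⟨δ, hδ, fun {a'} ha' haa' => ?_⟩
    refine hδ' _ _ _ _ _ _ (hglob a' ha') (hglob a ha) (hΦ a' ha') (hΦ a ha) ?_
    rw [hf1 a' ha', hf1 a ha, ← neg_sub', abs_neg]
    exact haa'
  refine ⟨fun a => F a 1, Φ, fun a ha => ⟨f a, F a, hflow a ha, hsign a ha, hf1 a ha, rfl, hΦ a ha⟩,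
    fun a ha g G hg hg1 => ?_, fun a ha g G Ψ hg hg1 hΨ => ?_, hcont, ?_⟩
  · obtain ⟨M, hM⟩ := exists_lipschitz_shooting hc hh
    have h1 := hM g G _ _ hg (hglob a ha).isDecaying
    rw [hg1, hf1 a ha, sub_self, abs_zero, mul_zero] at h1
    exact sub_eq_zero.1 (abs_nonpos_iff.1 h1)
  · by_contra hne
    obtain ⟨δ, hδ, hδ'⟩ := exists_delta_limit hc hh (abs_pos.2 (sub_ne_zero.2 hne))
    refine lt_irrefl _ (hδ' _ _ _ _ _ _ hg (hglob a ha) hΨ (hΦ a ha) ?_)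
    rw [hg1, hf1 a ha, sub_self, abs_zero]
    exact hδ
  · apply Set.Subset.antisymm
    · rintro _ ⟨a, ha, rfl⟩
      exact (hsign a ha 1 one_pos).2.trans_le ((hglob a ha).limit_bounds hc hh (hΦ a ha) one_pos).1
    · intro y (hy : 0 < y)
      obtain ⟨δ, hδ, hδ'⟩ := exists_delta_limit hc hh hy
      have ha₁ : 0 < δ / 2 := half_pos hδ
      have ha₂ : 0 < C * y := mul_pos hc.C_pos hy
      have h1 : Φ (δ / 2) ≤ y := by
        have := hδ' _ _ _ _ _ _ (hglob _ ha₁) (isGlobalDecaying_zero hh) (hΦ _ ha₁)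
          tendsto_const_nhds (by
            rw [hf1 _ ha₁, sub_zero, abs_neg, abs_of_pos ha₁]; exact half_lt_self hδ)
        rw [sub_zero] at this
        exact (le_abs_self _).trans this.le
      have h2 : y ≤ Φ (C * y) := by
        have h3 := (hglob _ ha₂).le_snd_one hc hh
        rw [hf1 _ ha₂, neg_neg] at h3
        exact (le_of_mul_le_mul_left h3 hc.C_pos).trans
          ((hglob _ ha₂).limit_bounds hc hh (hΦ _ ha₂) one_pos).1
      exact isPreconnected_Ioi.intermediate_value (Set.mem_Ioi.2 ha₁) (Set.mem_Ioi.2 ha₂) hcont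
        (Set.mem_Icc.2 ⟨h1, h2⟩)

end Planar

/-! ### The substitution `P` and its inverse -/

theorem hasDerivAt_P (p : ℕ) (v : ℝ) :
    HasDerivAt (P p) ((1 - Real.exp (2 * v)) ^ (p - 1)) v := by
  have h1 : Continuous fun s : ℝ => (1 - Real.exp (2 * s)) ^ (p - 1) := by fun_prop
  exact (h1.integral_hasStrictDerivAt 0 v).hasDerivAt

theorem continuous_P (p : ℕ) : Continuous (P p) :=
  continuous_iff_continuousAt.2 fun v => (hasDerivAt_P p v).continuousAt

@[simp] theorem P_zero (p : ℕ) : P p 0 = 0 := by simp [P]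

theorem one_sub_exp_pos {v : ℝ} (hv : v < 0) : 0 < 1 - Real.exp (2 * v) := by
  rw [sub_pos, Real.exp_lt_one_iff]; linarith

theorem one_sub_exp_nonneg {v : ℝ} (hv : v ≤ 0) : 0 ≤ 1 - Real.exp (2 * v) := by
  rw [sub_nonneg, Real.exp_le_one_iff]; linarith

theorem strictMonoOn_P (p : ℕ) : StrictMonoOn (P p) (Set.Iic 0) := by
  refine strictMonoOn_of_hasDerivWithinAt_pos (convex_Iic 0) (continuous_P p).continuousOn
    (fun x _ => (hasDerivAt_P p x).hasDerivWithinAt) fun x hx => ?_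
  rw [interior_Iic] at hx
  exact pow_pos (one_sub_exp_pos hx) _

theorem P_neg (p : ℕ) {v : ℝ} (hv : v < 0) : P p v < 0 := by
  simpa using strictMonoOn_P p hv.le (Set.self_mem_Iic) hv

theorem P_nonpos (p : ℕ) {v : ℝ} (hv : v ≤ 0) : P p v ≤ 0 := by
  simpa using (strictMonoOn_P p).monotoneOn hv (Set.self_mem_Iic) hv

/-- Whatever the sign of `v` and the parity of `p`, the restoring term has the sign opposite to
`P v`. -/
theorem P_mul_pow_nonpos {p : ℕ} (hp : 1 ≤ p) (v : ℝ) :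
    P p v * (1 - Real.exp (2 * v)) ^ p ≤ 0 := by
  rcases le_total v 0 with hv | hv
  · exact mul_nonpos_of_nonpos_of_nonneg (P_nonpos p hv) (pow_nonneg (one_sub_exp_nonneg hv) _)
  · have h1 : 0 ≤ (-1) ^ (p - 1) * P p v := by
      rw [P, ← intervalIntegral.integral_const_mul]
      refine intervalIntegral.integral_nonneg hv fun s hs => ?_
      rw [← mul_pow]
      refine pow_nonneg ?_ _
      have : 1 ≤ Real.exp (2 * s) := Real.one_le_exp (by linarith [hs.1])
      linarith
    have h2 : 0 ≤ (-1) ^ p * (1 - Real.exp (2 * v)) ^ p := by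
      rw [← mul_pow]
      refine pow_nonneg ?_ _
      have : 1 ≤ Real.exp (2 * v) := Real.one_le_exp (by linarith)
      linarith
    have h3 : ((-1 : ℝ) ^ (p - 1)) * (-1) ^ p = -1 := by
      rw [← pow_add]
      exact Odd.neg_one_pow ⟨p - 1, by omega⟩
    have h4 := mul_nonneg h1 h2
    have h5 : (-1) ^ (p - 1) * P p v * ((-1) ^ p * (1 - Real.exp (2 * v)) ^ p)
        = ((-1) ^ (p - 1) * (-1) ^ p) * (P p v * (1 - Real.exp (2 * v)) ^ p) := by ring
    rw [h5, h3] at h4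
    linarith

theorem P_ne_zero (p : ℕ) {v : ℝ} (hv : v ≠ 0) : P p v ≠ 0 := by
  rcases hv.lt_or_gt with hv | hv
  · exact (P_neg p hv).ne
  · have h1 : 0 < (-1) ^ (p - 1) * P p v := by
      rw [P, ← intervalIntegral.integral_const_mul]
      refine intervalIntegral.intervalIntegral_pos_of_pos_on
        (Continuous.intervalIntegrable (by fun_prop) _ _) (fun s hs => ?_) hv
      rw [← mul_pow]
      refine pow_pos ?_ _
      have : 1 < Real.exp (2 * s) := Real.one_lt_exp_iff.2 (by linarith [hs.1])
      linarith
    intro h0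
    rw [h0, mul_zero] at h1
    exact lt_irrefl _ h1

theorem surjOn_P (p : ℕ) : Set.SurjOn (P p) (Set.Iic 0) (Set.Iic 0) := by
  intro y (hy : y ≤ 0)
  set k : ℝ := (1 - Real.exp (2 * (-1))) ^ (p - 1) with hk
  have hk0 : 0 < k := pow_pos (one_sub_exp_pos (by norm_num)) _
  -- `P` grows at least linearly, with slope `k`, to the left of `-1`
  have hd : ∀ v, HasDerivAt (fun v => P p v - k * v) ((1 - Real.exp (2 * v)) ^ (p - 1) - k * 1) v :=
    fun v => (hasDerivAt_P p v).sub ((hasDerivAt_id v).const_mul k)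
  have hmono : MonotoneOn (fun v => P p v - k * v) (Set.Iic (-1)) := by
    refine monotoneOn_of_hasDerivAt (convex_Iic _)
      (fun v _ => (hd v).continuousAt.continuousWithinAt) (fun v _ => hd v) fun v hv => ?_
    have hv' : v ∈ Set.Iic (-1 : ℝ) := interior_subset hv
    rw [Set.mem_Iic] at hv'
    rw [mul_one, sub_nonneg]
    refine pow_le_pow_left₀ (one_sub_exp_nonneg (by norm_num)) ?_ _
    have := Real.exp_le_exp.2 (show 2 * v ≤ 2 * -1 by linarith)
    linarith
  set v₀ := min (-1) (y / k - 1) with hv₀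
  have h1 := hmono (Set.mem_Iic.2 (min_le_left (-1) (y / k - 1))) Set.self_mem_Iic (min_le_left _ _)
  have h2 := P_neg p (show (-1 : ℝ) < 0 by norm_num)
  have h3 : k * v₀ ≤ y - k := by
    have : k * v₀ ≤ k * (y / k - 1) := mul_le_mul_of_nonneg_left (min_le_right _ _) hk0.le
    rwa [mul_sub, mul_div_cancel₀ _ hk0.ne', mul_one] at this
  have h4 : P p v₀ ≤ y := by
    simp only at h1
    linarith
  have hv₀0 : v₀ ≤ 0 := (min_le_left _ _).trans (by norm_num)
  obtain ⟨v, hv, hvy⟩ := intermediate_value_Icc hv₀0 (continuous_P p).continuousOn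
    (show y ∈ Set.Icc (P p v₀) (P p 0) from ⟨h4, by rwa [P_zero]⟩)
  exact ⟨v, hv.2, hvy⟩

theorem Q_nonpos (p : ℕ) {y : ℝ} (hy : y ≤ 0) : Q p y ≤ 0 :=
  Function.invFunOn_mem (surjOn_P p hy)

theorem P_Q (p : ℕ) {y : ℝ} (hy : y ≤ 0) : P p (Q p y) = y :=
  Function.invFunOn_eq (surjOn_P p hy)

theorem Q_P (p : ℕ) {v : ℝ} (hv : v ≤ 0) : Q p (P p v) = v :=
  (strictMonoOn_P p).injOn (Q_nonpos p (P_nonpos p hv)) hv (P_Q p (P_nonpos p hv))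

theorem strictMonoOn_Q (p : ℕ) : StrictMonoOn (Q p) (Set.Iic 0) := by
  intro x hx y hy hxy
  by_contra! hcon
  have := (strictMonoOn_P p).monotoneOn (Q_nonpos p hy) (Q_nonpos p hx) hcon
  rw [P_Q p hx, P_Q p hy] at this
  exact absurd hxy this.not_gt

@[simp] theorem Q_zero (p : ℕ) : Q p 0 = 0 := by
  simpa using Q_P p (le_refl (0 : ℝ))

theorem Q_neg (p : ℕ) {y : ℝ} (hy : y < 0) : Q p y < 0 := by
  simpa using strictMonoOn_Q p hy.le Set.self_mem_Iic hy

theorem continuousAt_Q (p : ℕ) {y : ℝ} (hy : y < 0) : ContinuousAt (Q p) y := by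
  refine ((strictMonoOn_Q p).mono Set.Iio_subset_Iic_self).continuousAt_of_image_mem_nhds
    (Iio_mem_nhds hy) ?_
  refine Filter.mem_of_superset (Iio_mem_nhds (Q_neg p hy)) fun v (hv : v < 0) => ?_
  exact ⟨P p v, P_neg p hv, Q_P p hv.le⟩

theorem hasDerivAt_Q (p : ℕ) {y : ℝ} (hy : y < 0) :
    HasDerivAt (Q p) ((1 - Real.exp (2 * Q p y)) ^ (p - 1))⁻¹ y := by
  refine (hasDerivAt_P p (Q p y)).of_local_left_inverse (continuousAt_Q p hy)
    (pow_pos (one_sub_exp_pos (Q_neg p hy)) _).ne' ?_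
  filter_upwards [Iio_mem_nhds hy] with x hx
  exact P_Q p (le_of_lt hx)

theorem tendsto_Q_zero (p : ℕ) : Tendsto (Q p) (𝓝[≤] 0) (𝓝 0) := by
  rw [tendsto_order]
  constructor
  · intro v hv
    have h1 : P p v < 0 := P_neg p hv
    filter_upwards [mem_nhdsWithin_of_mem_nhds (Ioi_mem_nhds h1), self_mem_nhdsWithin] with y hy hy0
    have := strictMonoOn_Q p h1.le hy0 hy
    rwa [Q_P p hv.le] at this
  · intro v hv
    filter_upwards [self_mem_nhdsWithin] with y hy
    exact (Q_nonpos p hy).trans_lt hv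

theorem tendsto_Q_atBot (p : ℕ) : Tendsto (Q p) atBot atBot := by
  rw [tendsto_atBot]
  intro v
  filter_upwards [eventually_le_atBot (P p (min v 0))] with y hy
  have h0 : min v 0 ≤ (0 : ℝ) := min_le_right _ _
  have h1 := (strictMonoOn_Q p).monotoneOn (hy.trans (P_nonpos p h0)) (P_nonpos p h0) hy
  rw [Q_P p h0] at h1
  exact h1.trans (min_le_left _ _)

/-! ### The nonlinearity -/

/-- The nonlinearity `(1 - e^{2 Q(x)})^p` of the second order equation, continued linearly with
slope `-2p` to the positive axis. -/
noncomputable def nonlin (p : ℕ) (x : ℝ) : ℝ :=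
  if x ≤ 0 then (1 - Real.exp (2 * Q p x)) ^ p else -(2 * p * x)

theorem nonlin_of_nonpos (p : ℕ) {x : ℝ} (hx : x ≤ 0) :
    nonlin p x = (1 - Real.exp (2 * Q p x)) ^ p := if_pos hx

theorem nonlin_of_pos (p : ℕ) {x : ℝ} (hx : 0 < x) : nonlin p x = -(2 * p * x) :=
  if_neg hx.not_ge

theorem nonlin_P (p : ℕ) {v : ℝ} (hv : v ≤ 0) : nonlin p (P p v) = (1 - Real.exp (2 * v)) ^ p := by
  rw [nonlin_of_nonpos p (P_nonpos p hv), Q_P p hv]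

theorem hasDerivAt_one_sub_exp_pow (p : ℕ) (v : ℝ) :
    HasDerivAt (fun v => (1 - Real.exp (2 * v)) ^ p)
      (-(2 * p * Real.exp (2 * v) * (1 - Real.exp (2 * v)) ^ (p - 1))) v := by
  have h1 : HasDerivAt (fun v : ℝ => 1 - Real.exp (2 * v)) (-(Real.exp (2 * v) * (2 * 1))) v :=
    (((hasDerivAt_id v).const_mul 2).exp).const_sub 1
  refine (h1.pow p).congr_deriv ?_
  ring

theorem one_sub_exp_pow_antitone (p : ℕ) {u v : ℝ} (huv : u ≤ v) (hv : v ≤ 0) :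
    (1 - Real.exp (2 * v)) ^ p ≤ (1 - Real.exp (2 * u)) ^ p := by
  refine pow_le_pow_left₀ (one_sub_exp_nonneg hv) ?_ _
  have := Real.exp_le_exp.2 (show 2 * u ≤ 2 * v by linarith)
  linarith

/-- The derivative of `(1 - e^{2v})^p + 2 p θ P(v)` is
`2 p (θ - e^{2v}) (1 - e^{2v})^{p-1}`; both for `θ = 1` and for `θ ≤ e^{2v}` its sign is known. -/
theorem hasDerivAt_one_sub_exp_pow_add (p : ℕ) (θ v : ℝ) :
    HasDerivAt (fun v => (1 - Real.exp (2 * v)) ^ p + 2 * p * θ * P p v)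
      (2 * p * (θ - Real.exp (2 * v)) * (1 - Real.exp (2 * v)) ^ (p - 1)) v := by
  refine ((hasDerivAt_one_sub_exp_pow p v).add
    ((hasDerivAt_P p v).const_mul (2 * p * θ))).congr_deriv ?_
  ring

theorem one_sub_exp_pow_le (p : ℕ) {u v : ℝ} (huv : u ≤ v) (hv : v ≤ 0) :
    (1 - Real.exp (2 * u)) ^ p - (1 - Real.exp (2 * v)) ^ p ≤ 2 * p * (P p v - P p u) := by
  have hmono : MonotoneOn (fun v => (1 - Real.exp (2 * v)) ^ p + 2 * p * 1 * P p v)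
      (Set.Iic 0) := by
    refine monotoneOn_of_hasDerivAt (convex_Iic _)
      (fun v _ => (hasDerivAt_one_sub_exp_pow_add p 1 v).continuousAt.continuousWithinAt)
      (fun v _ => hasDerivAt_one_sub_exp_pow_add p 1 v) fun v hv => ?_
    have hv' : v ∈ Set.Iic (0 : ℝ) := interior_subset hv
    have h1 := one_sub_exp_nonneg hv'
    positivity
  have h1 := hmono (huv.trans hv) hv huv
  simp only [mul_one] at h1
  linarith

theorem le_one_sub_exp_pow {p : ℕ} (hp : 1 ≤ p) {θ v : ℝ} (hv : v ≤ 0)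
    (hθ : θ ≤ Real.exp (2 * v)) : 2 * p * θ * (-P p v) ≤ (1 - Real.exp (2 * v)) ^ p := by
  have hanti : AntitoneOn (fun v => (1 - Real.exp (2 * v)) ^ p + 2 * p * θ * P p v)
      (Set.Icc v 0) := by
    refine antitoneOn_of_hasDerivAt (convex_Icc _ _)
      (fun v _ => (hasDerivAt_one_sub_exp_pow_add p θ v).continuousAt.continuousWithinAt)
      (fun v _ => hasDerivAt_one_sub_exp_pow_add p θ v) fun x hx => ?_
    have hx' := interior_subset hx
    have h1 := pow_nonneg (one_sub_exp_nonneg hx'.2) (p - 1)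
    have h2 := Real.exp_le_exp.2 (show 2 * v ≤ 2 * x by linarith [hx'.1])
    have h3 : 2 * (p : ℝ) * (θ - Real.exp (2 * x)) ≤ 0 :=
      mul_nonpos_of_nonneg_of_nonpos (by positivity) (by linarith)
    exact mul_nonpos_of_nonpos_of_nonneg h3 h1
  have h1 := hanti ⟨le_rfl, hv⟩ ⟨hv, le_rfl⟩ hv
  have h2 : p ≠ 0 := by omega
  simp only [P_zero, mul_zero, Real.exp_zero, sub_self, zero_pow h2, add_zero] at h1
  linarith

/-- The substitution `P` is chosen such that this nonlinearity is Lipschitz. -/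
theorem isNonlinearity_nonlin {p : ℕ} (hp : 1 ≤ p) : IsNonlinearity (nonlin p) (2 * p) := by
  have hp0 : p ≠ 0 := by omega
  have hp' : (0 : ℝ) < p := by exact_mod_cast hp
  have hzero : nonlin p 0 = 0 := by simp [nonlin_of_nonpos, hp0]
  have hnn : ∀ x, x ≤ 0 → 0 ≤ nonlin p x := fun x hx => by
    rw [nonlin_of_nonpos p hx]
    exact pow_nonneg (one_sub_exp_nonneg (Q_nonpos p hx)) _
  have hanti : Antitone (nonlin p) := by
    intro x y hxy
    rcases le_or_gt y 0 with hy | hy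
    · rw [nonlin_of_nonpos p hy, nonlin_of_nonpos p (hxy.trans hy)]
      exact one_sub_exp_pow_antitone p ((strictMonoOn_Q p).monotoneOn (hxy.trans hy) hy hxy)
        (Q_nonpos p hy)
    · rw [nonlin_of_pos p hy]
      rcases le_or_gt x 0 with hx | hx
      · exact (neg_nonpos.2 (by positivity)).trans (hnn x hx)
      · rw [nonlin_of_pos p hx]
        exact neg_le_neg (mul_le_mul_of_nonneg_left hxy (by positivity))
  have hlip0 : ∀ x y, x ≤ y → y ≤ 0 → nonlin p x - nonlin p y ≤ 2 * p * (y - x) := by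
    intro x y hxy hy
    have h1 := one_sub_exp_pow_le p ((strictMonoOn_Q p).monotoneOn (hxy.trans hy) hy hxy)
      (Q_nonpos p hy)
    rwa [P_Q p hy, P_Q p (hxy.trans hy), ← nonlin_of_nonpos p hy,
      ← nonlin_of_nonpos p (hxy.trans hy)] at h1
  have hlip1 : ∀ x y, x ≤ y → nonlin p x - nonlin p y ≤ 2 * p * (y - x) := by
    intro x y hxy
    rcases le_or_gt y 0 with hy | hy
    · exact hlip0 x y hxy hy
    · rw [nonlin_of_pos p hy]
      rcases le_or_gt x 0 with hx | hx
      · have := hlip0 x 0 hx le_rfl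
        rw [hzero] at this
        linarith
      · rw [nonlin_of_pos p hx]
        linarith
  refine ⟨hzero, hanti, fun x y => ?_, fun x => ?_, fun x hx => ?_⟩
  · rcases le_total x y with hxy | hxy
    · rw [abs_of_nonneg (sub_nonneg.2 (hanti hxy)), abs_sub_comm, abs_of_nonneg (sub_nonneg.2 hxy)]
      exact hlip1 x y hxy
    · rw [abs_sub_comm, abs_of_nonneg (sub_nonneg.2 (hanti hxy)), abs_of_nonneg (sub_nonneg.2 hxy)]
      exact hlip1 y x hxy
  · rcases le_or_gt x 0 with hx | hx
    · rw [nonlin_of_nonpos p hx]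
      exact pow_le_one₀ (one_sub_exp_nonneg (Q_nonpos p hx))
        (by linarith [Real.exp_pos (2 * Q p x)])
    · rw [nonlin_of_pos p hx]
      have : 0 < 2 * (p : ℝ) * x := by positivity
      linarith
  · rw [nonlin_of_nonpos p hx.le]
    exact pow_pos (one_sub_exp_pos (Q_neg p hx)) _

/-- The slope of the nonlinearity at `0` from the left is `-2p`; only this bound is used. -/
theorem eventually_le_nonlin {p : ℕ} (hp : 1 ≤ p) {θ : ℝ} (hθ : θ < 1) :
    ∀ᶠ x in 𝓝[≤] (0 : ℝ), 2 * p * θ * (-x) ≤ nonlin p x := by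
  have h1 : Tendsto (fun x => Real.exp (2 * Q p x)) (𝓝[≤] 0) (𝓝 1) := by
    have h2 := (Real.continuous_exp.tendsto (2 * 0)).comp ((tendsto_Q_zero p).const_mul 2)
    rwa [mul_zero, Real.exp_zero] at h2
  filter_upwards [h1.eventually (eventually_ge_nhds hθ), self_mem_nhdsWithin] with x hx hx0
  have h2 := le_one_sub_exp_pow hp (Q_nonpos p hx0) hx
  rwa [P_Q p hx0, ← nonlin_of_nonpos p hx0] at h2

/-! ### The background -/

/-- The consequences of the growth conditions that are used: `N` and `σ N` are bounded above and
away from `0` on all of `(0, ∞)`. -/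
structure IsBackground (N σ : ℝ → ℝ) (K : ℝ) : Prop where
  one_le : 1 ≤ K
  N_lower : ∀ r, 0 < r → K⁻¹ ≤ N r
  N_upper : ∀ r, 0 < r → N r ≤ K
  m_lower : ∀ r, 0 < r → K⁻¹ ≤ σ r * N r
  m_upper : ∀ r, 0 < r → σ r * N r ≤ K
  N_diff : ∀ r, 0 < r → DifferentiableAt ℝ N r
  σ_diff : ∀ r, 0 < r → DifferentiableAt ℝ σ r
  logCoeff_nonneg : ∀ r, 0 < r → 0 ≤ logCoeff N σ r
  N_zero : Tendsto N (𝓝[>] 0) (𝓝 1)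
  logCoeff_zero : Tendsto (logCoeff N σ) (𝓝[>] 0) (𝓝 0)

theorem hasDerivAt_sigma_mul_N {N σ : ℝ → ℝ} {r : ℝ} (hr : 0 < r) (hN : N r ≠ 0) (hσ : σ r ≠ 0)
    (hN' : DifferentiableAt ℝ N r) (hσ' : DifferentiableAt ℝ σ r) :
    HasDerivAt (fun r => σ r * N r) (logCoeff N σ r * (σ r * N r) / r) r := by
  refine (hσ'.hasDerivAt.mul hN'.hasDerivAt).congr_deriv ?_
  unfold logCoeff
  field_simp

/-- A positive continuous function on `(0, ∞)` with positive limits at both ends is bounded above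
and away from `0`. -/
theorem exists_bounds_of_tendsto {g : ℝ → ℝ} (hg : ContinuousOn g (Set.Ioi 0))
    (hpos : ∀ r, 0 < r → 0 < g r) {l l' : ℝ} (hl : 0 < l) (hl' : 0 < l')
    (h0 : Tendsto g (𝓝[>] 0) (𝓝 l)) (h1 : Tendsto g atTop (𝓝 l')) :
    ∃ a b : ℝ, 0 < a ∧ ∀ r, 0 < r → a ≤ g r ∧ g r ≤ b := by
  have h2 : ∀ᶠ r in 𝓝[>] (0 : ℝ), l / 2 < g r ∧ g r < l + 1 :=
    (h0.eventually_const_lt (half_lt_self hl)).and (h0.eventually_lt_const (lt_add_one l))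
  have h3 : ∀ᶠ r in atTop, l' / 2 < g r ∧ g r < l' + 1 :=
    (h1.eventually_const_lt (half_lt_self hl')).and (h1.eventually_lt_const (lt_add_one l'))
  obtain ⟨s, hs, hs'⟩ := mem_nhdsGT_iff_exists_Ioo_subset.1 h2
  obtain ⟨R, hR⟩ := eventually_atTop.1 h3
  have hs0 : (0 : ℝ) < s := hs
  have hc : IsCompact (Set.Icc s (max s R)) := isCompact_Icc
  have hne : (Set.Icc s (max s R)).Nonempty := ⟨s, le_rfl, le_max_left _ _⟩
  have hsub : Set.Icc s (max s R) ⊆ Set.Ioi 0 := fun x hx => hs0.trans_le hx.1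
  obtain ⟨x, hx, hxm⟩ := hc.exists_isMinOn hne (hg.mono hsub)
  obtain ⟨y, hy, hym⟩ := hc.exists_isMaxOn hne (hg.mono hsub)
  have hx0 : 0 < g x := hpos x (hsub hx)
  refine ⟨min (g x) (min (l / 2) (l' / 2)), max (g y) (max (l + 1) (l' + 1)),
    lt_min hx0 (lt_min (half_pos hl) (half_pos hl')), fun r hr => ?_⟩
  rcases lt_or_ge r s with hrs | hrs
  · have h4 : l / 2 < g r ∧ g r < l + 1 := hs' ⟨hr, hrs⟩
    exact ⟨(min_le_right _ _).trans ((min_le_left _ _).trans h4.1.le),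
      h4.2.le.trans ((le_max_left _ _).trans (le_max_right _ _))⟩
  · rcases le_or_gt r (max s R) with hrR | hrR
    · exact ⟨(min_le_left _ _).trans (hxm ⟨hrs, hrR⟩), (hym ⟨hrs, hrR⟩).trans (le_max_left _ _)⟩
    · have h4 := hR r ((le_max_right _ _).trans hrR.le)
      exact ⟨(min_le_right _ _).trans ((min_le_right _ _).trans h4.1.le),
        h4.2.le.trans ((le_max_right _ _).trans (le_max_right _ _))⟩

/-- The decay of the logarithmic derivative at infinity bounds `σ N`: the function
`log (σ N) + (A / γ) r^{-γ}` is eventually antitone. -/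
theorem exists_upper_bound_of_logCoeff {m ℓ : ℝ → ℝ} (hm : ∀ r, 0 < r → 0 < m r)
    (hm' : ∀ r, 0 < r → HasDerivAt m (ℓ r * m r / r) r) (hℓ : ∀ r, 0 < r → 0 ≤ ℓ r) {γ : ℝ}
    (hγ : 0 < γ) (hO : ℓ =O[atTop] fun r : ℝ => r ^ (-γ)) :
    MonotoneOn m (Set.Ioi 0) ∧ ∃ b : ℝ, ∀ r, 0 < r → m r ≤ b := by
  have hmono : MonotoneOn m (Set.Ioi 0) := by
    refine monotoneOn_of_hasDerivAt (convex_Ioi _)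
      (fun r hr => (hm' r hr).continuousAt.continuousWithinAt)
      (fun r hr => hm' r (interior_subset hr)) fun r hr => ?_
    have hr' : 0 < r := interior_subset hr
    exact div_nonneg (mul_nonneg (hℓ r hr') (hm r hr').le) hr'.le
  refine ⟨hmono, ?_⟩
  obtain ⟨A, hA⟩ := hO.bound
  obtain ⟨R, hR⟩ := eventually_atTop.1 hA
  set S := max R 1 with hS
  have hS0 : 0 < S := lt_max_of_lt_right one_pos
  have hd : ∀ r, 0 < r → HasDerivAt (fun r => Real.log (m r) + A / γ * r ^ (-γ))
      (ℓ r * m r / r / m r + A / γ * (-γ * r ^ (-γ - 1))) r := fun r hr =>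
    ((hm' r hr).log (hm r hr).ne').add ((Real.hasDerivAt_rpow_const (Or.inl hr.ne')).const_mul _)
  have hanti : AntitoneOn (fun r => Real.log (m r) + A / γ * r ^ (-γ)) (Set.Ici S) := by
    refine antitoneOn_of_hasDerivAt (convex_Ici _)
      (fun r hr => (hd r (hS0.trans_le hr)).continuousAt.continuousWithinAt)
      (fun r hr => hd r (hS0.trans_le (interior_subset hr))) fun r hr => ?_
    have hrS : S ≤ r := interior_subset hr
    have hr' : 0 < r := hS0.trans_le hrS
    have h1 := hR r ((le_max_left _ _).trans hrS)
    rw [Real.norm_of_nonneg (hℓ r hr'), Real.norm_of_nonneg (Real.rpow_nonneg hr'.le _)] at h1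
    have h2 : ℓ r * m r / r / m r = ℓ r / r := by
      have := (hm r hr').ne'
      field_simp
    have h3 : A / γ * (-γ * r ^ (-γ - 1)) = -(A * r ^ (-γ) / r) := by
      rw [Real.rpow_sub_one hr'.ne']
      field_simp
    rw [h2, h3, ← sub_eq_add_neg, ← sub_div]
    exact div_nonpos_of_nonpos_of_nonneg (by linarith) hr'.le
  have hA0 : 0 ≤ A := by
    have h1 := (norm_nonneg _).trans (hR S (le_max_left _ _))
    rw [Real.norm_of_nonneg (Real.rpow_nonneg hS0.le _)] at h1
    exact nonneg_of_mul_nonneg_left h1 (Real.rpow_pos_of_pos hS0 _)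
  set b := Real.exp (Real.log (m S) + A / γ * S ^ (-γ)) with hb
  have hge : ∀ r, S ≤ r → m r ≤ b := fun r hr => by
    have hr' : 0 < r := hS0.trans_le hr
    have h1 := hanti Set.self_mem_Ici hr hr
    have h2 : 0 ≤ A / γ * r ^ (-γ) :=
      mul_nonneg (div_nonneg hA0 hγ.le) (Real.rpow_nonneg hr'.le _)
    rw [← Real.exp_log (hm r hr')]
    refine Real.exp_le_exp.2 ?_
    simp only at h1
    linarith
  refine ⟨b, fun r hr => ?_⟩
  rcases le_total r S with h1 | h1
  · exact (hmono hr (Set.mem_Ioi.2 hS0) h1).trans (hge S le_rfl)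
  · exact hge r h1

theorem exists_isBackground {N σ : ℝ → ℝ} {σ₀ : ℝ}
    (hN_reg : ContDiffOn ℝ 1 N (Set.Ioi 0)) (hσ_reg : ContDiffOn ℝ 1 σ (Set.Ioi 0))
    (hN_cont : ContinuousWithinAt N (Set.Ici 0) 0) (hσ_cont : ContinuousWithinAt σ (Set.Ici 0) 0)
    (hN_pos : ∀ r, 0 ≤ r → 0 < N r) (hσ_pos : ∀ r, 0 ≤ r → 0 < σ r)
    (hN_zero : N 0 = 1) (hσ_zero : σ 0 = σ₀)
    (h_bound : ∀ r, 0 < r → 0 ≤ logCoeff N σ r ∧ logCoeff N σ r < 1)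
    (h_N_infty : ∃ Ninf : ℝ, 0 < Ninf ∧ Tendsto N atTop (𝓝 Ninf))
    (h_infty : ∃ γ : ℝ, 0 < γ ∧ logCoeff N σ =O[atTop] (fun r : ℝ => r ^ (-γ)))
    (h_zero : Tendsto (logCoeff N σ) (𝓝[>] 0) (𝓝 0)) :
    ∃ K, IsBackground N σ K := by
  have hNd : ∀ r, 0 < r → DifferentiableAt ℝ N r := fun r hr =>
    (hN_reg.differentiableOn one_ne_zero).differentiableAt (Ioi_mem_nhds hr)
  have hσd : ∀ r, 0 < r → DifferentiableAt ℝ σ r := fun r hr =>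
    (hσ_reg.differentiableOn one_ne_zero).differentiableAt (Ioi_mem_nhds hr)
  have hN0 : Tendsto N (𝓝[>] 0) (𝓝 1) :=
    hN_zero ▸ hN_cont.tendsto.mono_left (nhdsWithin_mono _ Set.Ioi_subset_Ici_self)
  have hσ0 : Tendsto σ (𝓝[>] 0) (𝓝 σ₀) :=
    hσ_zero ▸ hσ_cont.tendsto.mono_left (nhdsWithin_mono _ Set.Ioi_subset_Ici_self)
  have hσ₀ : 0 < σ₀ := hσ_zero ▸ hσ_pos 0 le_rfl
  obtain ⟨Ninf, hNinf, hNlim⟩ := h_N_infty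
  obtain ⟨a, b, ha, hab⟩ := exists_bounds_of_tendsto hN_reg.continuousOn
    (fun r hr => hN_pos r hr.le) one_pos hNinf hN0 hNlim
  obtain ⟨γ, hγ, hO⟩ := h_infty
  obtain ⟨hmono, b', hb'⟩ := exists_upper_bound_of_logCoeff (m := fun r => σ r * N r)
    (fun r hr => mul_pos (hσ_pos r hr.le) (hN_pos r hr.le))
    (fun r hr => hasDerivAt_sigma_mul_N hr (hN_pos r hr.le).ne' (hσ_pos r hr.le).ne' (hNd r hr)
      (hσd r hr)) (fun r hr => (h_bound r hr).1) hγ hO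
  have hlow : ∀ r, 0 < r → σ₀ ≤ σ r * N r := by
    intro r hr
    have h1 : Tendsto (fun r => σ r * N r) (𝓝[>] 0) (𝓝 (σ₀ * 1)) := hσ0.mul hN0
    rw [mul_one] at h1
    refine le_of_tendsto h1 ?_
    filter_upwards [Ioo_mem_nhdsGT hr] with s hs
    exact hmono hs.1 hr hs.2.le
  set K := max (max 1 (max b b')) (max a⁻¹ σ₀⁻¹) with hK
  have hKa : K⁻¹ ≤ a := by
    rw [inv_le_comm₀ (by positivity) ha]
    exact (le_max_left _ _).trans (le_max_right _ _)
  have hKσ : K⁻¹ ≤ σ₀ := by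
    rw [inv_le_comm₀ (by positivity) hσ₀]
    exact (le_max_right _ _).trans (le_max_right _ _)
  have hKb : b ≤ K := ((le_max_left _ _).trans (le_max_right _ _)).trans (le_max_left _ _)
  have hKb' : b' ≤ K := ((le_max_right _ _).trans (le_max_right _ _)).trans (le_max_left _ _)
  exact ⟨K, (le_max_left _ _).trans (le_max_left _ _), fun r hr => hKa.trans (hab r hr).1,
    fun r hr => (hab r hr).2.trans hKb, fun r hr => hKσ.trans (hlow r hr),
    fun r hr => (hb' r hr).trans hKb', hNd, hσd, fun r hr => (h_bound r hr).1, hN0, h_zero⟩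

section Background

variable {N σ : ℝ → ℝ} {K : ℝ}

theorem IsBackground.K_pos (hb : IsBackground N σ K) : 0 < K := one_pos.trans_le hb.one_le

theorem IsBackground.N_pos (hb : IsBackground N σ K) {r : ℝ} (hr : 0 < r) : 0 < N r :=
  (inv_pos.2 hb.K_pos).trans_le (hb.N_lower r hr)

theorem IsBackground.m_pos (hb : IsBackground N σ K) {r : ℝ} (hr : 0 < r) : 0 < σ r * N r :=
  (inv_pos.2 hb.K_pos).trans_le (hb.m_lower r hr)

theorem IsBackground.σ_pos (hb : IsBackground N σ K) {r : ℝ} (hr : 0 < r) : 0 < σ r :=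
  pos_of_mul_pos_left (hb.m_pos hr) (hb.N_pos hr).le

theorem IsBackground.hasDerivAt_m (hb : IsBackground N σ K) {r : ℝ} (hr : 0 < r) :
    HasDerivAt (fun r => σ r * N r) (logCoeff N σ r * (σ r * N r) / r) r :=
  hasDerivAt_sigma_mul_N hr (hb.N_pos hr).ne' (hb.σ_pos hr).ne' (hb.N_diff r hr) (hb.σ_diff r hr)

/-- The coefficient `α = 1 / (σ N)` of the planar system. -/
noncomputable def coeffA (N σ : ℝ → ℝ) (r : ℝ) : ℝ := (σ r * N r)⁻¹

/-- The coefficient `β = (2p - 1) σ / r²` of the planar system. -/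
noncomputable def coeffB (p : ℕ) (σ : ℝ → ℝ) (r : ℝ) : ℝ := (2 * p - 1) * σ r / r ^ 2

theorem IsBackground.isCoeffPair (hb : IsBackground N σ K) {p : ℕ} (hp : 1 ≤ p) :
    IsCoeffPair (coeffA N σ) (coeffB p σ) (K ^ 2)⁻¹ (2 * p * K ^ 2) := by
  have hK := hb.K_pos
  have hK1 := hb.one_le
  have hp' : (1 : ℝ) ≤ p := by exact_mod_cast hp
  have hKsq : K ≤ K ^ 2 := by nlinarith
  have hσl : ∀ r, 0 < r → (K ^ 2)⁻¹ ≤ σ r := fun r hr => by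
    have h1 := hb.m_lower r hr
    have h2 := mul_le_mul_of_nonneg_left (hb.N_upper r hr) (hb.σ_pos hr).le
    rw [sq, mul_inv, inv_mul_le_iff₀ hK, mul_comm]
    exact h1.trans h2
  have hσu : ∀ r, 0 < r → σ r ≤ K ^ 2 := fun r hr => by
    have h1 := hb.m_upper r hr
    have h2 := mul_le_mul_of_nonneg_left (hb.N_lower r hr) (hb.σ_pos hr).le
    have h3 := h2.trans h1
    rwa [← div_eq_mul_inv, div_le_iff₀ hK, ← sq] at h3
  refine ⟨by positivity, fun r hr => ?_, fun r hr => ?_, fun r hr => ?_, fun r hr => ?_,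
    fun r hr => ?_, fun r hr => ?_⟩
  · exact inv_anti₀ (hb.m_pos hr) ((hb.m_upper r hr).trans hKsq)
  · have h1 : (σ r * N r)⁻¹ ≤ K := by
      rw [inv_le_comm₀ (hb.m_pos hr) hK]; exact hb.m_lower r hr
    exact h1.trans (hKsq.trans (by nlinarith [sq_nonneg K]))
  · refine div_le_div_of_nonneg_right ?_ (by positivity)
    nlinarith [hσl r hr, hb.σ_pos hr]
  · refine div_le_div_of_nonneg_right ?_ (by positivity)
    have h1 := mul_le_mul_of_nonneg_left (hσu r hr) (show (0 : ℝ) ≤ 2 * p - 1 by linarith)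
    nlinarith [sq_nonneg K]
  · exact ((hb.hasDerivAt_m hr).inv (hb.m_pos hr).ne').continuousAt.continuousWithinAt
  · have h1 : DifferentiableAt ℝ (coeffB p σ) r := by
      unfold coeffB
      exact ((hb.σ_diff r hr).const_mul _).div (by fun_prop) (pow_ne_zero 2 (Set.mem_Ioi.1 hr).ne')
    exact h1.continuousAt.continuousWithinAt

end Background

section Solutions

variable {N σ : ℝ → ℝ} {K : ℝ} {p : ℕ}

/-! ### From solutions of the boundary value problem to the planar system -/

theorem IsSolution.hasDerivAt_w (hb : IsBackground N σ K) {wh Φ : ℝ} {w u : ℝ → ℝ}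
    (hs : IsSolution p N σ wh Φ w u) {r : ℝ} (hr : 0 < r) :
    HasDerivAt w (-(coeffA N σ r * u r) * w r) r := by
  refine (hs.differentiable_w r hr).hasDerivAt.congr_deriv ?_
  have h1 := hs.eq_w r hr
  have hm := hb.m_pos hr
  have h2 : √(σ r * N r) * √(σ r * N r) = σ r * N r := Real.mul_self_sqrt hm.le
  have h3 : 0 < √(σ r * N r) := Real.sqrt_pos.2 hm
  unfold coeffA
  rw [← h2]
  field_simp at h1 ⊢
  linarith

theorem IsSolution.hasDerivAt_F (hb : IsBackground N σ K) (hp : 1 ≤ p) {wh Φ : ℝ} {w u : ℝ → ℝ}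
    (hs : IsSolution p N σ wh Φ w u) {r : ℝ} (hr : 0 < r) :
    HasDerivAt (fun s => (1 - w s ^ 2) ^ (p - 1) * u s) (coeffB p σ r * (1 - w r ^ 2) ^ p) r := by
  have hd : DifferentiableAt ℝ (fun s => (1 - w s ^ 2) ^ (p - 1) * u s) r :=
    ((((hs.differentiable_w r hr).pow 2).const_sub 1).pow (p - 1)).mul (hs.differentiable_u r hr)
  refine hd.hasDerivAt.congr_deriv ?_
  have h1 := hs.eq_u r hr
  have hp' : (1 : ℝ) ≤ p := by exact_mod_cast hp
  have hm : 0 < σ r * (2 * p - 1) := mul_pos (hb.σ_pos hr) (by linarith)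
  have h2 : √(σ r * (2 * p - 1)) * √(σ r * (2 * p - 1)) = σ r * (2 * p - 1) :=
    Real.mul_self_sqrt hm.le
  have h3 : 0 < √(σ r * (2 * p - 1)) := Real.sqrt_pos.2 hm
  unfold coeffB
  rw [mul_comm (2 * (p : ℝ) - 1), ← h2]
  set X := deriv (fun s => (1 - w s ^ 2) ^ (p - 1) * u s) r
  field_simp at h1 ⊢
  linarith

theorem IsSolution.tendsto_F_zero {wh Φ : ℝ} {w u : ℝ → ℝ} (hs : IsSolution p N σ wh Φ w u) :
    Tendsto (fun s => (1 - w s ^ 2) ^ (p - 1) * u s) (𝓝[>] 0) (𝓝 0) := by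
  have h1 := ((tendsto_const_nhds (x := (1 : ℝ))).sub (hs.w_zero.pow 2)).pow (p - 1)
  simpa using h1.mul hs.u_zero

/-- If `w(0) < 1`, then `F = (1 - w²)^{p-1} u` would satisfy `F' ≥ η / r²` near `r = 0`. -/
theorem IsSolution.wh_eq_one (hb : IsBackground N σ K) (hp : 1 ≤ p) {wh Φ : ℝ} {w u : ℝ → ℝ}
    (hs : IsSolution p N σ wh Φ w u) (h0 : 0 ≤ wh) (h1 : wh ≤ 1) : wh = 1 := by
  by_contra hne
  have hlt : wh < 1 := h1.lt_of_ne hne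
  have hq : 0 < (1 - wh ^ 2) ^ p := pow_pos (by nlinarith) _
  have hlim : Tendsto (fun r => (1 - w r ^ 2) ^ p) (𝓝[>] 0) (𝓝 ((1 - wh ^ 2) ^ p)) :=
    ((tendsto_const_nhds (x := (1 : ℝ))).sub (hs.w_zero.pow 2)).pow p
  have hev := (hlim.eventually_const_lt (half_lt_self hq)).and
    (hs.tendsto_F_zero.eventually_const_lt (show (-1 : ℝ) < 0 by norm_num))
  obtain ⟨r₀, hr₀, hsub⟩ := mem_nhdsGT_iff_exists_Ioo_subset.1 hev
  have hc := hb.isCoeffPair hp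
  refine not_bddBelow_of_deriv_ge hr₀ (mul_pos hc.c_pos (half_pos hq))
    (fun r hr => hs.hasDerivAt_F hb hp hr.1) (fun r hr => ?_) fun r hr => (hsub hr).2.le
  rw [mul_div_right_comm]
  exact mul_le_mul (hc.β_lower r hr.1) (hsub hr).1.le (half_pos hq).le (hc.β_pos hr.1).le

/-- The first equation is linear in `w`, so `w` has no zero when `w(0) = 1`. -/
theorem IsSolution.w_pos (hb : IsBackground N σ K) {Φ : ℝ} {w u : ℝ → ℝ}
    (hs : IsSolution p N σ 1 Φ w u) {r : ℝ} (hr : 0 < r) : 0 < w r := by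
  have hc : ContinuousOn (fun r => coeffA N σ r * u r) (Set.Ioi 0) := fun x hx =>
    ((((hb.hasDerivAt_m hx).inv (hb.m_pos hx).ne').continuousAt).mul
      (hs.differentiable_u x hx).continuousAt).continuousWithinAt
  set U : ℝ → ℝ := fun r => ∫ s in (1 : ℝ)..r, coeffA N σ s * u s with hU
  have hU' : ∀ x, 0 < x → HasDerivAt U (coeffA N σ x * u x) x := by
    intro x hx
    refine intervalIntegral.integral_hasDerivAt_right ?_
      (hc.stronglyMeasurableAtFilter isOpen_Ioi x hx) (hc.continuousAt (Ioi_mem_nhds hx))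
    refine (hc.mono fun y hy => ?_).intervalIntegrable
    exact (lt_min one_pos hx).trans_le hy.1
  have hd : ∀ x, 0 < x → HasDerivAt (fun x => w x * Real.exp (U x)) 0 x := fun x hx => by
    refine ((hs.hasDerivAt_w hb hx).mul (hU' x hx).exp).congr_deriv ?_
    ring
  have hcont : ContinuousOn (fun x => w x * Real.exp (U x)) (Set.Ioi 0) := fun x hx =>
    (hd x hx).continuousAt.continuousWithinAt
  have hmono := monotoneOn_of_hasDerivAt (convex_Ioi 0) hcont
    (fun x hx => hd x (interior_subset hx)) fun _ _ => le_rfl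
  have hanti := antitoneOn_of_hasDerivAt (convex_Ioi 0) hcont
    (fun x hx => hd x (interior_subset hx)) fun _ _ => le_rfl
  obtain ⟨s, hs1, hs0, hsr⟩ := ((hs.w_zero.eventually_const_lt one_pos).and
    (Ioo_mem_nhdsGT hr)).exists
  have h1 : w s * Real.exp (U s) ≤ w r * Real.exp (U r) := hmono hs0 hr hsr.le
  exact pos_of_mul_pos_left ((mul_pos hs1 (Real.exp_pos _)).trans_le h1) (Real.exp_pos _).le

/-- Solutions of the boundary value problem with `w(0) = 1` take values in `0 < w < 1` and yield
solutions of the planar system with `f < 0 < F`. The product `f F` is antitone whatever the range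
of `w` is, and tends to `0` at `r = 0`; therefore `f²` is monotone. So `w` cannot return to `1`
after exceeding it, and if `w` touches `1` then `f = 0` on an initial interval, hence everywhere. -/
theorem IsSolution.planar (hb : IsBackground N σ K) (hp : 1 ≤ p) {Φ : ℝ} {w u : ℝ → ℝ}
    (hs : IsSolution p N σ 1 Φ w u) :
    (∀ r, 0 < r → 0 < w r ∧ w r < 1) ∧
      IsFlowOn (coeffA N σ) (coeffB p σ) (nonlin p) (Set.Ioi 0) (fun r => P p (Real.log (w r)))
        (fun r => (1 - w r ^ 2) ^ (p - 1) * u r) ∧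
      (∀ r, 0 < r → P p (Real.log (w r)) < 0 ∧ 0 < (1 - w r ^ 2) ^ (p - 1) * u r) ∧
      Tendsto (fun r => (1 - w r ^ 2) ^ (p - 1) * u r) atTop (𝓝 Φ) := by
  set f : ℝ → ℝ := fun r => P p (Real.log (w r)) with hf
  set F : ℝ → ℝ := fun r => (1 - w r ^ 2) ^ (p - 1) * u r with hF
  have hc := hb.isCoeffPair hp
  have hh := isNonlinearity_nonlin hp
  have hw : ∀ r, 0 < r → 0 < w r := fun r hr => hs.w_pos hb hr
  have hexp : ∀ r, 0 < r → Real.exp (2 * Real.log (w r)) = w r ^ 2 := fun r hr => by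
    rw [mul_comm, ← Real.rpow_def_of_pos (hw r hr)]
    exact_mod_cast Real.rpow_natCast (w r) 2
  have hwc : ContinuousOn w (Set.Ioi 0) := fun r hr =>
    (hs.differentiable_w r hr).continuousAt.continuousWithinAt
  have hlogc : ContinuousOn (fun r => Real.log (w r)) (Set.Ioi 0) :=
    hwc.log fun r hr => (hw r hr).ne'
  have hf' : ∀ r, 0 < r → HasDerivAt f (-(coeffA N σ r * F r)) r := fun r hr => by
    refine ((hasDerivAt_P p _).comp r ((hs.hasDerivAt_w hb hr).log (hw r hr).ne')).congr_deriv ?_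
    rw [hexp r hr, mul_div_assoc, div_self (hw r hr).ne']
    simp only [hF]
    ring
  have hF' : ∀ r, 0 < r → HasDerivAt F (coeffB p σ r * (1 - w r ^ 2) ^ p) r := fun r hr =>
    hs.hasDerivAt_F hb hp hr
  have hf0 : Tendsto f (𝓝[>] 0) (𝓝 0) := by
    have h1 : Tendsto (fun r => Real.log (w r)) (𝓝[>] 0) (𝓝 0) := by
      simpa using hs.w_zero.log one_ne_zero
    have h2 := ((continuous_P p).tendsto 0).comp h1
    rwa [P_zero] at h2
  have hF0 : Tendsto F (𝓝[>] 0) (𝓝 0) := hs.tendsto_F_zero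
  have hprod : ∀ r, 0 < r → f r * F r ≤ 0 := by
    have hd : ∀ r, 0 < r → HasDerivAt (fun r => f r * F r)
        (-(coeffA N σ r * F r) * F r + f r * (coeffB p σ r * (1 - w r ^ 2) ^ p)) r := fun r hr =>
      (hf' r hr).mul (hF' r hr)
    have hanti : AntitoneOn (fun r => f r * F r) (Set.Ioi 0) := by
      refine antitoneOn_of_hasDerivAt (convex_Ioi _)
        (fun r hr => (hd r hr).continuousAt.continuousWithinAt)
        (fun r hr => hd r (interior_subset hr)) fun r hr => ?_
      have hr' : 0 < r := interior_subset hr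
      have h1 := P_mul_pow_nonpos hp (Real.log (w r))
      rw [hexp r hr'] at h1
      have h2 := mul_nonpos_of_nonneg_of_nonpos (hc.β_pos hr').le h1
      have h3 := mul_nonneg (hc.α_pos hr').le (sq_nonneg (F r))
      simp only [hf]
      nlinarith
    intro r hr
    have hlim : Tendsto (fun r => f r * F r) (𝓝[>] 0) (𝓝 0) := by simpa using hf0.mul hF0
    refine ge_of_tendsto hlim ?_
    filter_upwards [Ioo_mem_nhdsGT hr] with s hs
    exact hanti hs.1 hr hs.2.le
  have hsq : MonotoneOn (fun r => (f r - 0) ^ 2) (Set.Ioi 0) := by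
    have hd : ∀ r, 0 < r → HasDerivAt (fun r => (f r - 0) ^ 2)
        (-(2 * coeffA N σ r * ((f r - 0) * (F r - 0)))) r := fun r hr => by
      refine hasDerivAt_sub_sq (g := fun _ => 0) (G := fun _ => 0) (hf' r hr) ?_
      simpa using hasDerivAt_const r (0 : ℝ)
    refine monotoneOn_of_hasDerivAt (convex_Ioi _)
      (fun r hr => (hd r hr).continuousAt.continuousWithinAt)
      (fun r hr => hd r (interior_subset hr)) fun r hr => ?_
    have hr' : 0 < r := interior_subset hr
    have h1 := mul_nonpos_of_nonneg_of_nonpos (hc.α_pos hr').le (hprod r hr')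
    rw [sub_zero, sub_zero]
    linarith
  simp only [sub_zero] at hsq
  have hlog : ∀ r, 0 < r → Real.log (w r) ≤ 0 := by
    intro r₁ hr₁
    by_contra! hcon
    have h1 : ∀ r ∈ Set.Ici r₁, -Real.log (w r) ≠ 0 := by
      intro r hr h0
      have h2 := hsq hr₁ (hr₁.trans_le hr) hr
      have h3 : f r = 0 := by simp only [hf, neg_eq_zero.1 h0, P_zero]
      have h4 : f r₁ ≠ 0 := P_ne_zero p hcon.ne'
      simp only [h3] at h2
      have := pow_pos (abs_pos.2 h4) 2
      rw [sq_abs] at this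
      linarith
    have h2 := neg_of_ne_zero Set.ordConnected_Ici
      (hlogc.mono fun x (hx : r₁ ≤ x) => hr₁.trans_le hx).neg h1 Set.self_mem_Ici
      (neg_lt_zero.2 hcon)
    obtain ⟨r, hr1, hr2⟩ := ((hs.w_infty.eventually_lt_const one_pos).and
      (eventually_ge_atTop r₁)).exists
    have h3 : -Real.log (w r) < 0 := h2 r hr2
    have h4 := Real.log_neg (hw r (hr₁.trans_le hr2)) hr1
    linarith
  have hflow : IsFlowOn (coeffA N σ) (coeffB p σ) (nonlin p) (Set.Ioi 0) f F := by
    intro r hr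
    refine ⟨hf' r hr, ?_⟩
    have h1 := hF' r hr
    rwa [← hexp r hr, ← nonlin_P p (hlog r hr)] at h1
  have hlog' : ∀ r, 0 < r → Real.log (w r) < 0 := by
    intro r₀ hr₀
    refine (hlog r₀ hr₀).lt_of_ne fun h0 => ?_
    have h1 : ∀ r ∈ Set.Ioc 0 r₀, f r = 0 := fun r hr => by
      have h2 := hsq hr.1 hr₀ hr.2
      have h3 : f r₀ = 0 := by simp only [hf, h0, P_zero]
      simp only [h3] at h2
      exact pow_eq_zero_iff two_ne_zero |>.1 (le_antisymm (by linarith) (sq_nonneg _))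
    have hr₁ : 0 < r₀ / 2 := half_pos hr₀
    have h2 : F (r₀ / 2) = 0 := by
      have h3 : HasDerivAt f 0 (r₀ / 2) := by
        refine (hasDerivAt_const (r₀ / 2) (0 : ℝ)).congr_of_eventuallyEq ?_
        filter_upwards [Ioo_mem_nhds hr₁ (half_lt_self hr₀)] with x hx
        exact h1 x ⟨hx.1, hx.2.le⟩
      have h4 := (hf' _ hr₁).unique h3
      have h5 := (hc.α_pos hr₁).ne'
      simpa [h5] using h4
    have h3 := fun r (hr : 0 < r) => hflow.eq_zero hc hh hr₁ (h1 _ ⟨hr₁, by linarith⟩) h2 hr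
    obtain ⟨r, hr1, hr2⟩ := ((hs.w_infty.eventually_lt_const one_pos).and
      (eventually_gt_atTop 0)).exists
    exact P_ne_zero p (Real.log_neg (hw r hr2) hr1).ne (h3 r hr2)
  have hFmono : StrictMonoOn F (Set.Ioi 0) := by
    refine strictMonoOn_of_hasDerivWithinAt_pos (convex_Ioi _) hflow.continuousOn_snd
      (fun x hx => (hflow x (interior_subset hx)).2.hasDerivWithinAt) fun x hx => ?_
    have hx' : 0 < x := interior_subset hx
    exact mul_pos (hc.β_pos hx') (hh.pos _ (P_neg p (hlog' x hx')))
  have hFpos : ∀ r, 0 < r → 0 < F r := by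
    intro r hr
    have h1 : 0 ≤ F (r / 2) := by
      refine le_of_tendsto hF0 ?_
      filter_upwards [Ioo_mem_nhdsGT (half_pos hr)] with s hs
      exact hFmono.monotoneOn hs.1 (Set.mem_Ioi.2 (half_pos hr)) hs.2.le
    exact h1.trans_lt (hFmono (Set.mem_Ioi.2 (half_pos hr)) hr (half_lt_self hr))
  refine ⟨fun r hr => ⟨hw r hr, ?_⟩, hflow, fun r hr => ⟨P_neg p (hlog' r hr), hFpos r hr⟩, ?_⟩
  · exact (Real.log_neg_iff (hw r hr)).1 (hlog' r hr)
  · have h1 := ((tendsto_const_nhds (x := (1 : ℝ))).sub (hs.w_infty.pow 2)).pow (p - 1)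
    simpa using h1.mul hs.u_infty

theorem IsSolution.signs (hb : IsBackground N σ K) (hp : 1 ≤ p) {Φ : ℝ} {w u : ℝ → ℝ}
    (hs : IsSolution p N σ 1 Φ w u) :
    (∀ r, 0 < r → 0 < w r ∧ 0 < u r) ∧ StrictAntiOn w (Set.Ioi 0) := by
  obtain ⟨h1, -, h2, -⟩ := hs.planar hb hp
  have hu : ∀ r, 0 < r → 0 < u r := fun r hr =>
    pos_of_mul_pos_right (h2 r hr).2 (pow_nonneg (by nlinarith [h1 r hr]) _)
  refine ⟨fun r hr => ⟨(h1 r hr).1, hu r hr⟩, ?_⟩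
  refine strictAntiOn_of_hasDerivWithinAt_neg (convex_Ioi _)
    (fun r hr => (hs.differentiable_w r hr).continuousAt.continuousWithinAt)
    (fun r hr => (hs.hasDerivAt_w hb (interior_subset hr)).hasDerivWithinAt) fun r hr => ?_
  have hr' : 0 < r := interior_subset hr
  exact mul_neg_of_neg_of_pos
    (neg_lt_zero.2 (mul_pos ((hb.isCoeffPair hp).α_pos hr') (hu r hr'))) (h1 r hr').1

end Solutions

section Converse

variable {N σ : ℝ → ℝ} {K : ℝ} {p : ℕ}

/-! ### From the planar system to solutions of the boundary value problem -/

/-- The derivative of `r^k F + k σ N r^{k-1} f`, which is a positive multiple of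
`r F / (σ N) - k |f|`. Its sign compares the logarithmic derivative of `|f|` with `k / r`. -/
theorem hasDerivAt_barrier (hb : IsBackground N σ K) {f F : ℝ → ℝ}
    (hfF : IsFlowOn (coeffA N σ) (coeffB p σ) (nonlin p) (Set.Ioi 0) f F) (k : ℝ) {r : ℝ}
    (hr : 0 < r) :
    HasDerivAt (fun r => r ^ k * F r + k * ((σ r * N r) * r ^ (k - 1)) * f r)
      (r ^ (k - 2) * σ r * ((2 * p - 1) * nonlin p (f r)
        + k * (k - 1 + logCoeff N σ r) * N r * f r)) r := by
  have h1 : HasDerivAt (fun r : ℝ => r ^ k) (k * r ^ (k - 1)) r :=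
    Real.hasDerivAt_rpow_const (Or.inl hr.ne')
  have h2 : HasDerivAt (fun r : ℝ => r ^ (k - 1)) ((k - 1) * r ^ (k - 1 - 1)) r :=
    Real.hasDerivAt_rpow_const (Or.inl hr.ne')
  refine ((h1.mul (hfF r hr).2).add
    ((((hb.hasDerivAt_m hr).mul h2).const_mul k).mul (hfF r hr).1)).congr_deriv ?_
  have h3 : r ^ (k - 1) = r ^ (k - 2) * r := by
    rw [← Real.rpow_add_one hr.ne']; congr 1; ring
  have h4 : r ^ k = r ^ (k - 2) * r ^ 2 := by
    rw [← Real.rpow_natCast r 2, ← Real.rpow_add hr]; congr 1; push_cast; ring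
  have h5 : r ^ (k - 1 - 1) = r ^ (k - 2) := by congr 1; ring
  have h6 := (hb.σ_pos hr).ne'
  have h7 := (hb.N_pos hr).ne'
  have h8 := hr.ne'
  simp only [Pi.mul_apply]
  rw [h5, h3, h4]
  unfold coeffA coeffB
  field_simp
  ring

theorem tendsto_barrier_zero (hb : IsBackground N σ K) (hp : 1 ≤ p) {f F : ℝ → ℝ}
    (hfF : IsGlobalDecaying (coeffA N σ) (coeffB p σ) (nonlin p) f F) {k : ℝ} (hk : 1 < k) :
    Tendsto (fun r => r ^ k * F r + k * ((σ r * N r) * r ^ (k - 1)) * f r) (𝓝[>] 0) (𝓝 0) := by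
  have hc := hb.isCoeffPair hp
  have hh := isNonlinearity_nonlin hp
  have hpow : ∀ j : ℝ, 0 < j → Tendsto (fun r : ℝ => r ^ j) (𝓝[>] 0) (𝓝 0) := fun j hj => by
    have h1 := (Real.continuousAt_rpow_const 0 j (Or.inr hj.le)).tendsto
    rw [Real.zero_rpow hj.ne'] at h1
    exact h1.mono_left nhdsWithin_le_nhds
  have h1 : Tendsto (fun r => r ^ k * F r) (𝓝[>] 0) (𝓝 0) := by
    refine squeeze_zero_norm' (a := fun r => r ^ k * F 1) ?_
      (by simpa using (hpow k (by linarith)).mul_const (F 1))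
    filter_upwards [Ioo_mem_nhdsGT one_pos] with r hr
    have h2 := hfF.monotoneOn_snd hc hh hr.1 (Set.mem_Ioi.2 one_pos) hr.2.le
    have h3 := (hfF.sign r hr.1).2
    have h4 := Real.rpow_nonneg hr.1.le k
    rw [Real.norm_of_nonneg (mul_nonneg h4 h3)]
    exact mul_le_mul_of_nonneg_left h2 h4
  have h2 : Tendsto (fun r => (σ r * N r) * r ^ (k - 1)) (𝓝[>] 0) (𝓝 0) := by
    refine squeeze_zero_norm' (a := fun r => K * r ^ (k - 1)) ?_
      (by simpa using (hpow (k - 1) (by linarith)).const_mul K)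
    filter_upwards [Ioo_mem_nhdsGT one_pos] with r hr
    have h4 := Real.rpow_nonneg hr.1.le (k - 1)
    rw [Real.norm_of_nonneg (mul_nonneg (hb.m_pos hr.1).le h4)]
    exact mul_le_mul_of_nonneg_right (hb.m_upper r hr.1) h4
  simpa using h1.add ((h2.const_mul k).mul (hfF.isDecaying.tendsto_fst hc hh))

/-- Upper barrier: `r F / (σ N)` is at most a constant multiple of `|f|`. -/
theorem IsGlobalDecaying.snd_le (hb : IsBackground N σ K) (hp : 1 ≤ p) {f F : ℝ → ℝ}
    (hfF : IsGlobalDecaying (coeffA N σ) (coeffB p σ) (nonlin p) f F) {r : ℝ} (hr : 0 < r) :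
    r * F r ≤ (2 * p * K + 1) * K * (-f r) := by
  have hp' : (1 : ℝ) ≤ p := by exact_mod_cast hp
  have hK := hb.one_le
  have hh := isNonlinearity_nonlin hp
  set k : ℝ := 2 * p * K + 1 with hk
  have hk1 : 1 < k := by nlinarith
  have hanti : AntitoneOn (fun r => r ^ k * F r + k * ((σ r * N r) * r ^ (k - 1)) * f r)
      (Set.Ioi 0) := by
    refine antitoneOn_of_hasDerivAt (convex_Ioi _)
      (fun r hr => (hasDerivAt_barrier hb hfF.flow k hr).continuousAt.continuousWithinAt)
      (fun r hr => hasDerivAt_barrier hb hfF.flow k (interior_subset hr)) fun r hr => ?_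
    have hr' : 0 < r := interior_subset hr
    have hf0 := (hfF.sign r hr').1
    refine mul_nonpos_of_nonneg_of_nonpos
      (mul_nonneg (Real.rpow_nonneg hr'.le _) (hb.σ_pos hr').le) ?_
    have h1 : nonlin p (f r) ≤ 2 * p * (-f r) := by
      have h2 := hh.lip (f r) 0
      rw [hh.zero, sub_zero, sub_zero, abs_of_nonpos hf0] at h2
      exact (le_abs_self _).trans h2
    have h2 : (2 * p - 1) * (2 * p) ≤ k * (k - 1 + logCoeff N σ r) * N r := by
      have h3 := hb.logCoeff_nonneg r hr'
      have h4 := hb.N_lower r hr'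
      have h5 : 1 ≤ K * N r := by
        rwa [inv_le_iff_one_le_mul₀ hb.K_pos, mul_comm] at h4
      have h6 : k - 1 = 2 * p * K := by rw [hk]; ring
      have h7 : 2 * p ≤ 2 * p * (K * N r) := le_mul_of_one_le_right (by linarith) h5
      have h8 : 2 * (p : ℝ) - 1 ≤ k := by nlinarith
      calc (2 * (p : ℝ) - 1) * (2 * p) ≤ k * (2 * p * (K * N r)) :=
            mul_le_mul h8 h7 (by linarith) (by linarith)
        _ ≤ k * (k - 1 + logCoeff N σ r) * N r := by
            rw [h6]
            have h9 := mul_nonneg (mul_nonneg (by linarith : 0 ≤ k) h3) (hb.N_pos hr').le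
            nlinarith
    have h3 := mul_le_mul_of_nonneg_left h1 (show (0 : ℝ) ≤ 2 * p - 1 by linarith)
    have h4 := mul_le_mul_of_nonneg_right h2 (neg_nonneg.2 hf0)
    linarith
  have h0 : r ^ k * F r + k * ((σ r * N r) * r ^ (k - 1)) * f r ≤ 0 := by
    refine ge_of_tendsto (tendsto_barrier_zero hb hp hfF hk1) ?_
    filter_upwards [Ioo_mem_nhdsGT hr] with s hs
    exact hanti hs.1 hr hs.2.le
  have h1 : r ^ k = r ^ (k - 1) * r := by
    rw [← Real.rpow_add_one hr.ne']; congr 1; ring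
  have h2 : r * F r ≤ k * (σ r * N r) * (-f r) := by
    refine le_of_mul_le_mul_left ?_ (Real.rpow_pos_of_pos hr (k - 1))
    rw [h1] at h0
    linarith
  refine h2.trans (mul_le_mul_of_nonneg_right ?_ (neg_nonneg.2 (hfF.sign r hr).1))
  exact mul_le_mul_of_nonneg_left (hb.m_upper r hr) (by linarith)

/-- Lower barrier: `|f| = O(r^{p + 1/2})` at `r = 0`. The exponent lies strictly between `p`, which
is what the decay of `u` requires, and the true exponent `2p`. -/
theorem IsGlobalDecaying.exists_decay (hb : IsBackground N σ K) (hp : 1 ≤ p) {f F : ℝ → ℝ}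
    (hfF : IsGlobalDecaying (coeffA N σ) (coeffB p σ) (nonlin p) f F) :
    ∃ A : ℝ, ∀ᶠ r in 𝓝[>] (0 : ℝ), -f r ≤ A * r ^ ((p : ℝ) + 1 / 2) := by
  have hp' : (1 : ℝ) ≤ p := by exact_mod_cast hp
  have hc := hb.isCoeffPair hp
  have hh := isNonlinearity_nonlin hp
  set k : ℝ := p + 1 / 2 with hk
  have hk1 : 1 < k := by linarith
  have hfleft : Tendsto f (𝓝[>] 0) (𝓝[≤] 0) := by
    refine tendsto_nhdsWithin_iff.2 ⟨hfF.isDecaying.tendsto_fst hc hh, ?_⟩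
    filter_upwards [self_mem_nhdsWithin] with r hr
    exact (hfF.sign r hr).1
  have hcoef : ∀ᶠ r in 𝓝[>] (0 : ℝ), k * (k - 1 + logCoeff N σ r) * N r < (2 * p - 1) * p := by
    have h1 : Tendsto (fun r => k * (k - 1 + logCoeff N σ r) * N r) (𝓝[>] 0)
        (𝓝 (k * (k - 1 + 0) * 1)) := ((hb.logCoeff_zero.const_add _).const_mul k).mul hb.N_zero
    refine h1.eventually_lt_const ?_
    rw [hk]
    nlinarith
  have hev := hcoef.and (hfleft.eventually
    (eventually_le_nonlin hp (show (1 / 2 : ℝ) < 1 by norm_num)))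
  obtain ⟨r₀, hr₀, hsub⟩ := mem_nhdsGT_iff_exists_Ioo_subset.1 hev
  have hr₀' : (0 : ℝ) < r₀ := hr₀
  have hmono : MonotoneOn (fun r => r ^ k * F r + k * ((σ r * N r) * r ^ (k - 1)) * f r)
      (Set.Ioo 0 r₀) := by
    refine monotoneOn_of_hasDerivAt (convex_Ioo _ _)
      (fun r hr => (hasDerivAt_barrier hb hfF.flow k hr.1).continuousAt.continuousWithinAt)
      (fun r hr => hasDerivAt_barrier hb hfF.flow k (interior_subset hr).1) fun r hr => ?_
    have hr' := interior_subset hr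
    obtain ⟨h1, h2⟩ := hsub hr'
    have hf0 := (hfF.sign r hr'.1).1
    refine mul_nonneg (mul_nonneg (Real.rpow_nonneg hr'.1.le _) (hb.σ_pos hr'.1).le) ?_
    have h3 := mul_le_mul_of_nonneg_right h1.le (neg_nonneg.2 hf0)
    have h4 := mul_le_mul_of_nonneg_left h2 (show (0 : ℝ) ≤ 2 * p - 1 by linarith)
    linarith
  have hJ : ∀ r ∈ Set.Ioo 0 r₀, k * (-f r) ≤ coeffA N σ r * (r * F r) := by
    intro r hr
    have h0 : 0 ≤ r ^ k * F r + k * ((σ r * N r) * r ^ (k - 1)) * f r := by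
      refine le_of_tendsto (tendsto_barrier_zero hb hp hfF hk1) ?_
      filter_upwards [Ioo_mem_nhdsGT hr.1] with s hs
      exact hmono ⟨hs.1, hs.2.trans hr.2⟩ hr hs.2.le
    have h1 : r ^ k = r ^ (k - 1) * r := by
      rw [← Real.rpow_add_one hr.1.ne']; congr 1; ring
    unfold coeffA
    rw [inv_mul_eq_div, le_div_iff₀ (hb.m_pos hr.1)]
    refine le_of_mul_le_mul_left ?_ (Real.rpow_pos_of_pos hr.1 (k - 1))
    rw [h1] at h0
    linarith
  have hd : ∀ r, 0 < r → HasDerivAt (fun r => -f r * r ^ (-k))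
      (- -(coeffA N σ r * F r) * r ^ (-k) + -f r * (-k * r ^ (-k - 1))) r := fun r hr =>
    ((hfF.flow r hr).1.neg).mul (Real.hasDerivAt_rpow_const (Or.inl hr.ne'))
  have hmono' : MonotoneOn (fun r => -f r * r ^ (-k)) (Set.Ioo 0 r₀) := by
    refine monotoneOn_of_hasDerivAt (convex_Ioo _ _)
      (fun r hr => (hd r hr.1).continuousAt.continuousWithinAt)
      (fun r hr => hd r (interior_subset hr).1) fun r hr => ?_
    have hr' := interior_subset hr
    have h1 := hJ r hr'
    have h2 : r ^ (-k) = r ^ (-k - 1) * r := by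
      rw [← Real.rpow_add_one hr'.1.ne']; congr 1; ring
    have h3 := Real.rpow_nonneg hr'.1.le (-k - 1)
    have h4 := mul_le_mul_of_nonneg_left h1 h3
    rw [h2]
    linarith
  refine ⟨-f (r₀ / 2) * (r₀ / 2) ^ (-k), ?_⟩
  filter_upwards [Ioo_mem_nhdsGT (half_pos hr₀')] with r hr
  have h1 := hmono' ⟨hr.1, hr.2.trans (half_lt_self hr₀')⟩
    ⟨half_pos hr₀', half_lt_self hr₀'⟩ hr.2.le
  simp only at h1
  rwa [Real.rpow_neg hr.1.le, ← div_eq_mul_inv, div_le_iff₀ (Real.rpow_pos_of_pos hr.1 _)] at h1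

/-- A solution of the planar system with `f < 0 < F` yields a solution of the boundary value
problem. The delicate point is `u(0) = 0`: in `u^p = F^p / h(f)^{p-1}` the upper barrier bounds the
numerator by a multiple of `(|f| / r)^p` and the denominator is at least a multiple of
`|f|^{p-1}`, so that `u^p` is at most a multiple of `|f| r^{-p}`. -/
theorem isSolution_of_flow (hb : IsBackground N σ K) (hp : 1 ≤ p) {f F : ℝ → ℝ} {Φ : ℝ}
    (hflow : IsFlowOn (coeffA N σ) (coeffB p σ) (nonlin p) (Set.Ioi 0) f F)
    (hsign : ∀ r, 0 < r → f r < 0 ∧ 0 < F r) (hΦ : Tendsto F atTop (𝓝 Φ)) :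
    IsSolution p N σ 1 Φ (fun r => Real.exp (Q p (f r)))
      (fun r => F r / (1 - Real.exp (Q p (f r)) ^ 2) ^ (p - 1)) := by
  have hfF : IsGlobalDecaying (coeffA N σ) (coeffB p σ) (nonlin p) f F :=
    ⟨hflow, fun r hr => ⟨(hsign r hr).1.le, (hsign r hr).2.le⟩⟩
  have hp' : (1 : ℝ) ≤ p := by exact_mod_cast hp
  have hc := hb.isCoeffPair hp
  have hh := isNonlinearity_nonlin hp
  have hexp : ∀ x : ℝ, Real.exp (Q p x) ^ 2 = Real.exp (2 * Q p x) := fun x => by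
    rw [← Real.exp_nat_mul]; norm_num
  have hy : ∀ r, 0 < r → 0 < 1 - Real.exp (Q p (f r)) ^ 2 := fun r hr => by
    rw [hexp]; exact one_sub_exp_pos (Q_neg p (hsign r hr).1)
  have hw : ∀ r, 0 < r → HasDerivAt (fun r => Real.exp (Q p (f r)))
      (Real.exp (Q p (f r)) * (((1 - Real.exp (2 * Q p (f r))) ^ (p - 1))⁻¹ *
        -(coeffA N σ r * F r))) r := fun r hr =>
    ((hasDerivAt_Q p (hsign r hr).1).comp r (hflow r hr).1).exp
  have hden : ∀ r, 0 < r → DifferentiableAt ℝ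
      (fun r => (1 - Real.exp (Q p (f r)) ^ 2) ^ (p - 1)) r := fun r hr =>
    (((hw r hr).differentiableAt.pow 2).const_sub 1).pow (p - 1)
  have hfleft : Tendsto f (𝓝[>] 0) (𝓝[≤] 0) := by
    refine tendsto_nhdsWithin_iff.2 ⟨hfF.isDecaying.tendsto_fst hc hh, ?_⟩
    filter_upwards [self_mem_nhdsWithin] with r hr
    exact (hfF.sign r hr).1
  have hw_infty : Tendsto (fun r => Real.exp (Q p (f r))) atTop (𝓝 0) := by
    have hfbot : Tendsto f atTop atBot := by
      have hF1 := (hsign 1 one_pos).2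
      set q := (K ^ 2)⁻¹ * F 1 with hq
      have hq0 : 0 < q := mul_pos hc.c_pos hF1
      have hd : ∀ r, 0 < r → HasDerivAt (fun r => f r + q * r)
          (-(coeffA N σ r * F r) + q * 1) r := fun r hr =>
        (hflow r hr).1.add ((hasDerivAt_id r).const_mul q)
      have hanti : AntitoneOn (fun r => f r + q * r) (Set.Ici 1) := by
        refine antitoneOn_of_hasDerivAt (convex_Ici _)
          (fun r hr => (hd r (one_pos.trans_le hr)).continuousAt.continuousWithinAt)
          (fun r hr => hd r (one_pos.trans_le (interior_subset hr))) fun r hr => ?_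
        have hr1 : 1 ≤ r := interior_subset hr
        have hr0 : 0 < r := one_pos.trans_le hr1
        have h1 := hfF.monotoneOn_snd hc hh (Set.mem_Ioi.2 one_pos) hr0 hr1
        have h2 := mul_le_mul (hc.α_lower r hr0) h1 hF1.le (hc.α_pos hr0).le
        linarith
      have h1 : Tendsto (fun r => f 1 + q * 1 + -q * r) atTop atBot :=
        tendsto_atBot_add_const_left _ _
          ((tendsto_const_mul_atBot_of_neg (neg_lt_zero.2 hq0)).2 tendsto_id)
      refine tendsto_atBot_mono' _ ?_ h1
      filter_upwards [eventually_ge_atTop 1] with r hr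
      have h2 := hanti Set.self_mem_Ici hr hr
      simp only at h2
      linarith
    exact Real.tendsto_exp_atBot.comp ((tendsto_Q_atBot p).comp hfbot)
  refine ⟨fun r hr => (hw r hr).differentiableAt, fun r hr => ?_, fun r hr => ?_, fun r hr => ?_,
    ?_, ?_, hw_infty, ?_⟩
  · exact (hflow r hr).2.differentiableAt.div (hden r hr) (pow_pos (hy r hr) _).ne'
  · rw [(hw r hr).deriv]
    have hm := hb.m_pos hr
    have h2 : √(σ r * N r) * √(σ r * N r) = σ r * N r := Real.mul_self_sqrt hm.le
    have h3 : 0 < √(σ r * N r) := Real.sqrt_pos.2 hm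
    have h4 : 0 < (1 - Real.exp (2 * Q p (f r))) ^ (p - 1) :=
      pow_pos (one_sub_exp_pos (Q_neg p (hsign r hr).1)) _
    unfold coeffA
    generalize √(σ r * N r) = q at h2 h3 ⊢
    rw [← h2, hexp]
    field_simp
    ring
  · have h1 : HasDerivAt (fun s => (1 - Real.exp (Q p (f s)) ^ 2) ^ (p - 1) *
        (F s / (1 - Real.exp (Q p (f s)) ^ 2) ^ (p - 1))) (coeffB p σ r * nonlin p (f r)) r := by
      refine (hflow r hr).2.congr_of_eventuallyEq ?_
      filter_upwards [Ioi_mem_nhds hr] with s hs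
      exact mul_div_cancel₀ _ (pow_pos (hy s hs) _).ne'
    rw [h1.deriv, nonlin_of_nonpos p (hsign r hr).1.le, hexp]
    have hm : 0 < σ r * (2 * p - 1) := mul_pos (hb.σ_pos hr) (by linarith)
    have h2 : √(σ r * (2 * p - 1)) * √(σ r * (2 * p - 1)) = σ r * (2 * p - 1) :=
      Real.mul_self_sqrt hm.le
    have h3 : 0 < √(σ r * (2 * p - 1)) := Real.sqrt_pos.2 hm
    unfold coeffB
    generalize √(σ r * (2 * p - 1)) = q at h2 h3 ⊢
    rw [mul_comm (2 * (p : ℝ) - 1), ← h2]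
    field_simp
    ring
  · have h1 := (Real.continuous_exp.tendsto 0).comp ((tendsto_Q_zero p).comp hfleft)
    rwa [Real.exp_zero] at h1
  · obtain ⟨A, hA⟩ := hfF.exists_decay hb hp
    set M := (2 * p * K + 1) * K with hM
    have hM0 : 0 < M := by have := hb.K_pos; positivity
    set u : ℝ → ℝ := fun r => F r / (1 - Real.exp (Q p (f r)) ^ 2) ^ (p - 1) with hu
    have hu0 : ∀ r, 0 < r → 0 < u r := fun r hr => div_pos (hsign r hr).2 (pow_pos (hy r hr) _)
    have hbound : ∀ᶠ r in 𝓝[>] (0 : ℝ), u r ^ p ≤ M ^ p * A * r ^ (1 / 2 : ℝ) := by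
      filter_upwards [hA, hfleft.eventually
        (eventually_le_nonlin hp (show (1 / 2 : ℝ) < 1 by norm_num)), self_mem_nhdsWithin]
        with r hAr hθ (hr : 0 < r)
      have hφ : 0 < -f r := neg_pos.2 (hsign r hr).1
      have hle : -f r ≤ nonlin p (f r) := by nlinarith
      have hn : (1 - Real.exp (Q p (f r)) ^ 2) ^ p = nonlin p (f r) := by
        rw [hexp, nonlin_of_nonpos p (hsign r hr).1.le]
      have h1 : u r ^ p = F r ^ p / nonlin p (f r) ^ (p - 1) := by
        rw [hu, ← hn]
        simp only
        rw [div_pow, ← pow_mul, ← pow_mul, mul_comm (p - 1)]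
      have h2 : F r ≤ M * (-f r) / r := by
        rw [le_div_iff₀ hr, mul_comm]; exact hfF.snd_le hb hp hr
      have h3 : F r ^ p ≤ (M * (-f r) / r) ^ p := pow_le_pow_left₀ (hsign r hr).2.le h2 p
      have h4 : (-f r) ^ (p - 1) ≤ nonlin p (f r) ^ (p - 1) := pow_le_pow_left₀ hφ.le hle _
      have h5 : (-f r) ^ p = (-f r) ^ (p - 1) * (-f r) := by
        rw [← pow_succ]; congr 1; omega
      have h6 : r ^ ((p : ℝ) + 1 / 2) = r ^ p * r ^ (1 / 2 : ℝ) := by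
        rw [Real.rpow_add hr, Real.rpow_natCast]
      calc u r ^ p ≤ (M * (-f r) / r) ^ p / (-f r) ^ (p - 1) := by
            rw [h1]; exact div_le_div₀ (by positivity) h3 (by positivity) h4
        _ = M ^ p * (-f r) / r ^ p := by
            rw [div_pow, mul_pow, h5]
            field_simp
        _ ≤ M ^ p * A * r ^ (1 / 2 : ℝ) := by
            rw [div_le_iff₀ (by positivity)]
            have h7 := mul_le_mul_of_nonneg_left hAr (pow_nonneg hM0.le p)
            rw [h6] at h7
            linarith
    have hlim : Tendsto (fun r : ℝ => M ^ p * A * r ^ (1 / 2 : ℝ)) (𝓝[>] 0) (𝓝 0) := by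
      have h1 := (Real.continuousAt_rpow_const 0 (1 / 2) (Or.inr (by norm_num))).tendsto
      rw [Real.zero_rpow (by norm_num)] at h1
      simpa using (h1.mono_left nhdsWithin_le_nhds).const_mul (M ^ p * A)
    rw [Metric.tendsto_nhds]
    intro ε hε
    filter_upwards [hbound, hlim.eventually_lt_const (pow_pos hε p), self_mem_nhdsWithin]
      with r h1 h2 (hr : 0 < r)
    rw [Real.dist_eq, sub_zero, abs_of_pos (hu0 r hr)]
    exact lt_of_pow_lt_pow_left₀ p hε.le (h1.trans_lt h2)
  · have h1 := ((tendsto_const_nhds (x := (1 : ℝ))).sub (hw_infty.pow 2)).pow (p - 1)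
    have h2 : Tendsto (fun r => F r / (1 - Real.exp (Q p (f r)) ^ 2) ^ (p - 1)) atTop _ :=
      hΦ.div h1 (by simp)
    simpa using h2

/-! ### Shooting slopes -/

/-- In the variable `τ = -ln r` the shooting slope is `F(1) / (σ(1) N(1))`. -/
theorem mem_shootingSlopes_of_flow (hb : IsBackground N σ K) {f F : ℝ → ℝ} {a : ℝ}
    (hflow : IsFlowOn (coeffA N σ) (coeffB p σ) (nonlin p) (Set.Ioi 0) f F)
    (hsign : ∀ r, 0 < r → f r < 0 ∧ 0 < F r) (hf1 : f 1 = -a) :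
    F 1 / (σ 1 * N 1) ∈ shootingSlopes p N σ a := by
  have hexp : ∀ τ : ℝ, HasDerivAt (fun τ : ℝ => Real.exp (-τ)) (-Real.exp (-τ)) τ := fun τ => by
    simpa using (hasDerivAt_neg τ).exp
  refine ⟨fun τ => f (Real.exp (-τ)),
    fun τ => Real.exp (-τ) * F (Real.exp (-τ)) / (σ (Real.exp (-τ)) * N (Real.exp (-τ))), ?_, ?_,
    fun τ _ => ?_, fun τ _ => ?_, fun τ _ => ⟨?_, ?_⟩⟩
  · simpa using hf1
  · simp
  · have hr := Real.exp_pos (-τ)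
    refine (((hflow _ hr).1.comp τ (hexp τ)).congr_deriv ?_).hasDerivWithinAt
    unfold coeffA
    field_simp
  · have hr := Real.exp_pos (-τ)
    have h1 : HasDerivAt (fun r => r * F r / (σ r * N r)) _ (Real.exp (-τ)) :=
      ((hasDerivAt_id _).mul (hflow _ hr).2).div (hb.hasDerivAt_m hr) (hb.m_pos hr).ne'
    refine ((h1.comp τ (hexp τ)).congr_deriv ?_).hasDerivWithinAt
    rw [nonlin_of_nonpos p (hsign _ hr).1.le]
    have h2 := (hb.σ_pos hr).ne'
    have h3 := (hb.N_pos hr).ne'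
    have h4 := hr.ne'
    unfold coeffB
    simp only [Pi.mul_apply]
    set r := Real.exp (-τ)
    field_simp
    ring
  · have hr := Real.exp_pos (-τ)
    exact div_pos (mul_pos hr (hsign _ hr).2) (hb.m_pos hr)
  · exact (hsign _ (Real.exp_pos _)).1.le

theorem exists_isDecaying_of_mem_shootingSlopes (hb : IsBackground N σ K) {a b : ℝ}
    (hab : b ∈ shootingSlopes p N σ a) :
    ∃ f F : ℝ → ℝ, IsDecaying (coeffA N σ) (coeffB p σ) (nonlin p) f F ∧ f 1 = -a ∧
      F 1 = b * (σ 1 * N 1) := by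
  obtain ⟨g, g', hg0, hg'0, hg, hg', hsign⟩ := hab
  have hmaps : Set.MapsTo (fun r => -Real.log r) (Set.Ioc (0 : ℝ) 1) (Set.Ici 0) := fun r hr =>
    neg_nonneg.2 (Real.log_nonpos hr.1.le hr.2)
  have hlogc : ContinuousOn (fun r => -Real.log r) (Set.Ioc (0 : ℝ) 1) :=
    (Real.continuousOn_log.mono fun r hr => (ne_of_gt hr.1)).neg
  have hlog : ∀ r : ℝ, 0 < r → HasDerivAt (fun r => -Real.log r) (-r⁻¹) r := fun r hr =>
    (Real.hasDerivAt_log hr.ne').neg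
  have hgc : ContinuousOn g (Set.Ici 0) := fun τ hτ => (hg τ hτ).continuousWithinAt
  have hgc' : ContinuousOn g' (Set.Ici 0) := fun τ hτ => (hg' τ hτ).continuousWithinAt
  have hmc : ContinuousOn (fun r => σ r * N r / r) (Set.Ioc (0 : ℝ) 1) := fun r hr =>
    ((hb.hasDerivAt_m hr.1).continuousAt.div continuousAt_id (ne_of_gt hr.1)).continuousWithinAt
  have hpos : ∀ r ∈ Set.Ioo (0 : ℝ) 1, 0 < -Real.log r := fun r hr =>
    neg_pos.2 (Real.log_neg hr.1 hr.2)
  refine ⟨fun r => g (-Real.log r), fun r => g' (-Real.log r) * (σ r * N r / r),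
    ⟨hgc.comp hlogc hmaps, (hgc'.comp hlogc hmaps).mul hmc, fun r hr => ?_, fun r hr => ?_⟩,
    by simpa using hg0, by simp [hg'0]⟩
  · have hτ := hpos r hr
    have h1 := (hg _ hτ.le).hasDerivAt (Ici_mem_nhds hτ)
    have h2 := (hg' _ hτ.le).hasDerivAt (Ici_mem_nhds hτ)
    have hσ := (hb.σ_pos hr.1).ne'
    have hN := (hb.N_pos hr.1).ne'
    have hr0 := (ne_of_gt hr.1 : r ≠ 0)
    rw [neg_neg, Real.exp_log hr.1] at h2
    constructor
    · refine (h1.comp r (hlog r hr.1)).congr_deriv ?_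
      unfold coeffA
      field_simp
    · refine ((h2.comp r (hlog r hr.1)).mul
        ((hb.hasDerivAt_m hr.1).div (hasDerivAt_id r) hr0)).congr_deriv ?_
      rw [nonlin_of_nonpos p (hsign _ hτ).2]
      unfold coeffB
      simp only [id_eq, Function.comp_apply, Pi.div_apply]
      field_simp
      ring
  · have h1 := hsign _ (hpos r hr)
    exact ⟨h1.2, mul_nonneg h1.1.le (div_nonneg (hb.m_pos hr.1).le hr.1.le)⟩

end Converse

end TypeII

/-! ### The boundary value problem -/

theorem mainTheorem4 (p : ℕ) (hp : 1 ≤ p) (N σ : ℝ → ℝ) (σ₀ : ℝ)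
    -- regular positive background, up to `r = 0`
    (hN_reg : ContDiffOn ℝ 1 N (Set.Ioi 0)) (hσ_reg : ContDiffOn ℝ 1 σ (Set.Ioi 0))
    (hN_cont : ContinuousWithinAt N (Set.Ici 0) 0) (hσ_cont : ContinuousWithinAt σ (Set.Ici 0) 0)
    (hN_pos : ∀ r, 0 ≤ r → 0 < N r) (hσ_pos : ∀ r, 0 ≤ r → 0 < σ r)
    (hN_zero : N 0 = 1) (hσ_zero : σ 0 = σ₀) (hσ₀ : 0 < σ₀ ∧ σ₀ < 1)
    -- growth conditions
    (h_bound : ∀ r, 0 < r → 0 ≤ TypeII.logCoeff N σ r ∧ TypeII.logCoeff N σ r < 1)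
    (h_N_infty : ∃ Ninf : ℝ, 0 < Ninf ∧ Tendsto N atTop (𝓝 Ninf))
    (h_N_near : ∃ δ : ℝ, 0 < δ ∧ (fun r : ℝ => r ^ 2 / N r) =O[𝓝[>] 0] (fun r : ℝ => r ^ δ))
    (h_infty : ∃ γ : ℝ, 0 < γ ∧ TypeII.logCoeff N σ =O[atTop] (fun r : ℝ => r ^ (-γ)))
    (h_zero : Tendsto (TypeII.logCoeff N σ) (𝓝[>] 0) (𝓝 0)) :
    -- for each prescribed `Φ > 0`, a nontrivial solution exists iff `wh = 1`
    (∀ wh : ℝ, 0 ≤ wh → wh ≤ 1 → ∀ Φ : ℝ, 0 < Φ →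
      ((∃ w u : ℝ → ℝ, TypeII.IsSolution p N σ wh Φ w u ∧ TypeII.Nontrivial w) ↔ wh = 1)) ∧
    -- every nontrivial solution is positive with `w` strictly decreasing
    (∀ wh : ℝ, 0 ≤ wh → wh ≤ 1 → ∀ Φ : ℝ, 0 < Φ → ∀ w u : ℝ → ℝ,
      TypeII.IsSolution p N σ wh Φ w u → TypeII.Nontrivial w →
        (∀ r, 0 < r → 0 < w r ∧ 0 < u r) ∧ StrictAntiOn w (Set.Ioi 0)) ∧
    -- the shooting slope is unique, and the limit of `u` is a continuous function of the
    -- shooting datum `a` with range `(0, ∞)`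
    (∃ b Φfun : ℝ → ℝ,
      (∀ a, 0 < a → TypeII.shootingSlopes p N σ a = {b a}) ∧
      (∀ a, 0 < a → ∃ w u : ℝ → ℝ, TypeII.IsSolution p N σ 1 (Φfun a) w u ∧
        TypeII.profile p w 0 = -a) ∧
      (∀ a, 0 < a → ∀ (Φ : ℝ) (w u : ℝ → ℝ), TypeII.IsSolution p N σ 1 Φ w u →
        TypeII.profile p w 0 = -a →
          HasDerivAt (TypeII.profile p w) (-(b a)) 0 ∧ Φ = Φfun a) ∧
      ContinuousOn Φfun (Set.Ioi 0) ∧ Φfun '' Set.Ioi 0 = Set.Ioi 0) := by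
  obtain ⟨K, hb⟩ := TypeII.exists_isBackground hN_reg hσ_reg hN_cont hσ_cont hN_pos hσ_pos hN_zero
    hσ_zero h_bound h_N_infty h_infty h_zero
  obtain ⟨B, Φfun, hex, huniq, hΦuniq, hcont, himage⟩ :=
    TypeII.exists_limit_function (hb.isCoeffPair hp) (TypeII.isNonlinearity_nonlin hp)
  have hm := hb.m_pos one_pos
  have hsol : ∀ a, 0 < a → ∃ w u : ℝ → ℝ, TypeII.IsSolution p N σ 1 (Φfun a) w u ∧
      TypeII.profile p w 0 = -a := by
    intro a ha
    obtain ⟨f, F, hflow, hsign, hf1, -, hΦ⟩ := hex a ha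
    refine ⟨_, _, TypeII.isSolution_of_flow hb hp hflow hsign hΦ, ?_⟩
    rw [TypeII.profile, Real.exp_zero, Real.log_exp, TypeII.P_Q p (hsign 1 one_pos).1.le, hf1]
  refine ⟨fun wh h0 h1 Φ hΦ => ⟨?_, ?_⟩, ?_, fun a => B a / (σ 1 * N 1), Φfun, fun a ha => ?_, hsol,
    fun a ha Φ w u hs hprof => ?_, hcont, himage⟩
  · rintro ⟨w, u, hs, -⟩
    exact hs.wh_eq_one hb hp h0 h1
  · rintro rfl
    obtain ⟨a, ha, rfl⟩ : Φ ∈ Φfun '' Set.Ioi 0 := himage.symm ▸ Set.mem_Ioi.2 hΦ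
    obtain ⟨w, u, hs, -⟩ := hsol a ha
    exact ⟨w, u, hs, 1, one_pos, (hs.w_pos hb one_pos).ne'⟩
  · intro wh h0 h1 Φ _ w u hs _
    obtain rfl := hs.wh_eq_one hb hp h0 h1
    exact hs.signs hb hp
  · apply Set.Subset.antisymm
    · intro b hab
      obtain ⟨f, F, hfF, hf1, hF1⟩ := TypeII.exists_isDecaying_of_mem_shootingSlopes hb hab
      rw [Set.mem_singleton_iff, eq_div_iff hm.ne', ← hF1]
      exact huniq a ha f F hfF hf1
    · obtain ⟨f, F, hflow, hsign, hf1, hF1, -⟩ := hex a ha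
      simp only [Set.singleton_subset_iff]
      rw [← hF1]
      exact TypeII.mem_shootingSlopes_of_flow hb hflow hsign hf1
  · obtain ⟨-, hflow, hsign, hΦ⟩ := hs.planar hb hp
    have hglob : TypeII.IsGlobalDecaying (TypeII.coeffA N σ) (TypeII.coeffB p σ) (TypeII.nonlin p)
        _ _ := ⟨hflow, fun r hr => ⟨(hsign r hr).1.le, (hsign r hr).2.le⟩⟩
    have hf1 : TypeII.P p (Real.log (w 1)) = -a := by
      rwa [TypeII.profile, Real.exp_zero] at hprof
    have hF1 := huniq a ha _ _ hglob.isDecaying hf1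
    refine ⟨?_, hΦuniq a ha _ _ Φ hglob hf1 hΦ⟩
    have h1 := (hflow (Real.exp 0) (Real.exp_pos 0)).1.comp 0 (Real.hasDerivAt_exp 0)
    refine h1.congr_deriv ?_
    simp only [Real.exp_zero]
    rw [hF1, TypeII.coeffA]
    ring
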